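/- For a sequence $T=(t_0,\dots,t_k)$ of positive integers, a \emph{$T$-layered graph} $G$ has layers $V_0,\dots,V_k$ with $V_i=[t_i]$ and, for each $i\in[k]$, a matching $E_i$ of size $\min(t_{i-1},t_i)$ between $V_{i-1}$ and $V_i$. For $i<i'$ let $G_{i\to i'}$ be the partial map that sends $v\in V_i$ to the vertex of $V_{i'}$ to which it is connected through $E_{i+1},\dots,E_{i'}$, if there is one. $G$ is \emph{nice} if, for all $i<i'$, exactly $\min_{i\le i''\le i'}t_{i''}$ vertices of $V_i$ are in the domain of $G_{i\to i'}$. Let $S=(s_1,s_2)$ be positive integers with $s_1<s_2$, let $c\ge 1$ and $1\le s\le s_1$. An \emph{$(s,c,S)$-almost nested block graph} is a nice $T$-layered graph, where $T$ is either $(s,s_2,\dots,s_2,s_1)$ or $(s_1,s_2,\dots,s_2,s)$, with $2c-1$ copies of $s_2$ (one of the two is fixed throughout; put $\ell=2c$). Let $\mathcal D_{s,c,S}$ be the uniform distribution on these graphs. For an injection $Z:[s]\to[s_1]$ let $\mathcal D^{Z}_{s,c,S}$ be $\mathcal D_{s,c,S}$ conditioned on the final matching being $Z$, that is, on $G_{0\to\ell}=Z$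 if the first layer has size $s$, and on $G_{0\to\ell}=Z^{-1}$ (as a partial map) if the last layer has size $s$. In a \emph{$1$-round $(s,c,S)$-protocol} $\Pi$, Alice gets the matchings $E_i$ with $i$ even and Bob gets those with $i$ odd; Alice sends one message, a bit string, to Bob, who then computes the output $\Pi(G)$ from his input and the message. A randomized protocol is a random deterministic protocol, chosen independently of the input. $\|\Pi\|$ is the largest number of bits sent, over all inputs and all random choices. \textbf{Lemma.} Let $s_1<s_2$ be positive integers, $S=(s_1,s_2)$, and let $c,C>0$ be integers. For all $1\le s\le s_1$, all injections $Y,N:[s]\to[s_1]$, and all randomized $1$-round $(s,c,S)$-protocols $\Pi$ with $\|\Pi\|\le C$, the total variation distance between the distribution of $\Pi(G)$ for $G\sim\mathcal D^{Y}_{s,c,S}$ and that for $G\sim\mathcal D^{N}_{s,c,S}$ is at most \[ 2s_2^2\cdot\left(\frac{40\,C}{s_2-s}\right)^{c/6}. \] -/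

import Mathlib

open MeasureTheory ProbabilityTheory

namespace FinalMatching

/-! ### Layered graphs

A sequence `T = (t_0, …, t_k)` is a list; its layers are `V_i = Fin t_i`. -/

/-- The entry `t_i` of the sequence `T` (and `0` beyond the end of `T`). -/
def layerSize (T : List ℕ) (i : ℕ) : ℕ := T.getD i 0

/-- The layer `V_i`. -/
abbrev Layer (T : List ℕ) (i : ℕ) : Type := Fin (layerSize T i)

/-- A `T`-layered graph. A matching between two layers is a partial bijection (`PEquiv`); the
field `edge i` is the matching `E_{i+1}` between `V_i` and `V_{i+1}`, and it has the largest
possible size `min (t_i, t_{i+1})`. -/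
@[ext]
structure LayeredGraph (T : List ℕ) where
  edge : (i : Fin (T.length - 1)) → Layer T i ≃. Layer T (i + 1)
  card_edge : ∀ i : Fin (T.length - 1),
    (Finset.univ.filter fun v : Layer T i => (edge i v).isSome).card
      = min (layerSize T i) (layerSize T (i + 1))

namespace LayeredGraph

variable {T : List ℕ}

/-- The matching between `V_i` and `V_{i+1}`, for every natural number `i` (empty out of range). -/
def step (G : LayeredGraph T) (i : ℕ) : Layer T i ≃. Layer T (i + 1) :=
  if h : i < T.length - 1 then G.edge ⟨i, h⟩ else ⊥

/-- The partial map `G_{i → j}`, for `i ≤ j`: a vertex of `V_i` is sent to the vertex of `V_j`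
that it is connected to, or to `none` if there is no such vertex. (For `j < i` it is empty.) -/
def path (G : LayeredGraph T) (i : ℕ) : (j : ℕ) → (Layer T i ≃. Layer T j)
  | 0 => if h : i = 0 then (finCongr (congrArg (layerSize T) h)).toPEquiv else ⊥
  | j + 1 =>
    if h : i = j + 1 then (finCongr (congrArg (layerSize T) h)).toPEquiv
    else (G.path i j).trans (G.step j)

/-- `G` is nice: between any two layers, as many vertices as possible are connected. -/
def Nice (G : LayeredGraph T) : Prop :=
  ∀ i j : ℕ, ∀ hij : i < j, j < T.length →
    (Finset.univ.filter fun v : Layer T i => (G.path i j v).isSome).card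
      = (Finset.Icc i j).inf' (Finset.nonempty_Icc.2 hij.le) (layerSize T)

/-- Vertex number `a` of the first layer is connected to vertex number `b` of the last layer,
that is, `G_{0 → ℓ}(a) = b`. -/
def Joins (G : LayeredGraph T) (a b : ℕ) : Prop :=
  ∃ (u : Layer T 0) (w : Layer T (T.length - 1)),
    (u : ℕ) = a ∧ (w : ℕ) = b ∧ G.path 0 (T.length - 1) u = some w

end LayeredGraph

/-! ### Nested block graphs -/

/-- `plug T c s` is `t_0 ‖ s^{(c)} ‖ t_1 ‖ ⋯ ‖ s^{(c)} ‖ t_k`. -/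
def plug : List ℕ → ℕ → ℕ → List ℕ
  | [], _, _ => []
  | [t], _, _ => [t]
  | t :: t' :: T, c, s => t :: (List.replicate c s ++ plug (t' :: T) c s)

/-- `nest c (s_1, …, s_k)`: start from `(s_1, s_1)` and plug `2c - 1` copies of `s_2`, then of
`s_3`, …, and finally of `s_k`. -/
def nest (c : ℕ) : List ℕ → List ℕ
  | [] => []
  | s₁ :: S => S.foldl (fun T s => plug T (2 * c - 1) s) [s₁, s₁]

/-- Which of the two extreme layers of an almost nested block graph has the special size. -/
inductive Side
  | left
  | right

/-- `nest_l (s, c, S)` and `nest_r (s, c, S)`: the sequence `nest c S` with its first,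
respectively its last, element replaced by `s`. -/
def almostNest (side : Side) (s c : ℕ) (S : List ℕ) : List ℕ :=
  match side with
  | .left => (nest c S).set 0 s
  | .right => (nest c S).set ((nest c S).length - 1) s

/-- The final matching of `G` is the injection `Z` from the layer of size `s` to the opposite
extreme layer. So `G_{0 → ℓ}` is `Z` if the first layer is the one of size `s`, and it is the
partial inverse of `Z` if the last layer is the one of size `s`. -/
def FinalMatchingEq {T : List ℕ} (side : Side) {s s₁ : ℕ} (Z : Fin s ↪ Fin s₁)
    (G : LayeredGraph T) : Prop :=
  match side with
  | .left => ∀ a b : ℕ, G.Joins a b ↔ ∃ x : Fin s, (x : ℕ) = a ∧ (Z x : ℕ) = b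
  | .right => ∀ a b : ℕ, G.Joins a b ↔ ∃ x : Fin s, (x : ℕ) = b ∧ (Z x : ℕ) = a

instance (T : List ℕ) : MeasurableSpace (LayeredGraph T) := ⊤

/-- The uniform distribution on the nice `T`-layered graphs. -/
noncomputable def niceDist (T : List ℕ) : Measure (LayeredGraph T) :=
  uniformOn {G | G.Nice}

/-- The distribution `𝒟_{s,c,S}` of a random almost nested block graph. -/
noncomputable def almostNestedDist (side : Side) (s c : ℕ) (S : List ℕ) :
    Measure (LayeredGraph (almostNest side s c S)) :=
  niceDist (almostNest side s c S)

/-- The distribution `𝒟_{s,c,S}^Z`: `𝒟_{s,c,S}` conditioned on the final matching being `Z`. -/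
noncomputable def almostNestedDistCond (side : Side) (s c : ℕ) (S : List ℕ) {s₁ : ℕ}
    (Z : Fin s ↪ Fin s₁) : Measure (LayeredGraph (almostNest side s c S)) :=
  cond (almostNestedDist side s c S) {G | FinalMatchingEq side Z G}

/-! ### Protocols -/

/-- Alice's input: the matchings `E_i` with `i` even, that is, `edge j` with `j = i - 1` odd. -/
abbrev AliceInput (T : List ℕ) : Type :=
  (j : {j : Fin (T.length - 1) // Odd (j : ℕ)}) → Layer T j.1 ≃. Layer T (j.1 + 1)

/-- Bob's input: the matchings `E_i` with `i` odd, that is, `edge j` with `j = i - 1` even. -/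
abbrev BobInput (T : List ℕ) : Type :=
  (j : {j : Fin (T.length - 1) // Even (j : ℕ)}) → Layer T j.1 ≃. Layer T (j.1 + 1)

def LayeredGraph.aliceInput {T : List ℕ} (G : LayeredGraph T) : AliceInput T :=
  fun j => G.edge j.1

def LayeredGraph.bobInput {T : List ℕ} (G : LayeredGraph T) : BobInput T :=
  fun j => G.edge j.1

/-- A transcript: the list of the messages (bit strings) sent so far. -/
abbrev Transcript : Type := List (List Bool)

/-- A deterministic `r`-round `T`-protocol with outputs in `O`: each player has a rule for the next
message and a rule for the output, depending on the own input and the transcript. -/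
structure DetProtocol (r : ℕ) (T : List ℕ) (O : Type*) where
  aliceMsg : AliceInput T → Transcript → List Bool
  bobMsg : BobInput T → Transcript → List Bool
  aliceOut : AliceInput T → Transcript → O
  bobOut : BobInput T → Transcript → O

namespace DetProtocol

variable {r : ℕ} {T : List ℕ} {O : Type*}

/-- The transcript after `n` rounds: Alice speaks in the rounds `1, 3, …`, Bob in `2, 4, …`. -/
def transcript (π : DetProtocol r T O) (G : LayeredGraph T) : ℕ → Transcript
  | 0 => []
  | n + 1 =>
    let t := π.transcript G n
    t ++ [if Odd (n + 1) then π.aliceMsg G.aliceInput t else π.bobMsg G.bobInput t]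

/-- The output after `r` rounds: the receiver of the last message produces it, so Bob if `r` is
odd and Alice if `r` is even. -/
def output (π : DetProtocol r T O) (G : LayeredGraph T) : O :=
  if Odd r then π.bobOut G.bobInput (π.transcript G r)
  else π.aliceOut G.aliceInput (π.transcript G r)

/-- The number of bits communicated on the input `G`. -/
def bits (π : DetProtocol r T O) (G : LayeredGraph T) : ℕ :=
  ((π.transcript G r).map List.length).sum

end DetProtocol

/-- A randomized protocol: a random deterministic protocol, on a space `Ω` of random strings. The
random strings are available to both players, which covers public and private randomness. -/
structure RandProtocol (r : ℕ) (T : List ℕ) (Ω O : Type*) [MeasurableSpace Ω]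
    [MeasurableSpace O] where
  det : Ω → DetProtocol r T O
  measurableSet_aliceMsg : ∀ a t m, MeasurableSet {ω | (det ω).aliceMsg a t = m}
  measurableSet_bobMsg : ∀ b t m, MeasurableSet {ω | (det ω).bobMsg b t = m}
  measurable_aliceOut : ∀ a t, Measurable fun ω => (det ω).aliceOut a t
  measurable_bobOut : ∀ b t, Measurable fun ω => (det ω).bobOut b t

namespace RandProtocol

variable {r : ℕ} {T : List ℕ} {Ω O : Type*} [MeasurableSpace Ω] [MeasurableSpace O]

/-- The communication cost `‖P‖`: the worst-case number of bits communicated, over all nice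
graphs and all random strings. -/
noncomputable def cost (P : RandProtocol r T Ω O) : ℕ∞ :=
  ⨆ (ω : Ω) (G : LayeredGraph T) (_ : G.Nice), (((P.det ω).bits G : ℕ) : ℕ∞)

/-- The distribution of the output `P(G)` for `G ∼ D` and random strings `ω ∼ μ`, where `ω` and `G`
are independent. -/
noncomputable def outputLaw (P : RandProtocol r T Ω O) (μ : Measure Ω)
    (D : Measure (LayeredGraph T)) : Measure O :=
  (μ.prod D).map fun p => (P.det p.1).output p.2

end RandProtocol

/-- The total variation distance of two probability measures. -/
noncomputable def tvDist {O : Type*} [MeasurableSpace O] (P Q : Measure O) : ℝ :=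
  ⨆ A : {A : Set O // MeasurableSet A}, |P.real A.1 - Q.real A.1|

end FinalMatching

open FinalMatching

open Equiv Finset BigOperators

namespace FinalMatching

/-! ### Averages over a symmetric group -/

section PermAverage

variable {X : Type*} [Fintype X] [DecidableEq X]

/-! Write M for s₂. All inner layers have size M, so every matching is induced by a permutation of
`Fin M`, and all matchings by equally many. A uniform layered graph thus comes from independent
uniform permutations α_i (Alice) and β_i (Bob), for i < c. Being nice with final matching Z says
exactly that the product α_{c-1} β_{c-1} ⋯ α_0 β_0 takes s prescribed values
(`almostNest_nice_and_final_iff`). It therefore suffices that conditioning on s values of the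
product hardly changes the mean of any test t(m(α), β), where m is the short message. Both final
matchings are then compared with the same unconditioned mean.

One value x ↦ y (`abs_expect_onePath_le`), on a set of n points: fix a message of probability P and
let D be n times the indicator of the path minus 1. The second moment over β of the mean of D on
this message involves pairs α, α' with a common β. Averaging over each β_i is Schur's lemma for the
standard representation: every α_i but the last contributes a factor (fix(α_i⁻¹α_i') - 1)/(n - 1).
Fixed-point counts have Poisson-like moments, so the (C+1)-st moment of the product of these c - 1
factors is at most Q^{C+1} with Q = ((C+2)/(n-1))^{c-1}. A message set of density P, even one as
small as 3^{-C}, then cannot raise the mean of the product much above Q. Summing over at most 3^C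
messages gives the error 2√(nQ).

Several values: they are prescribed one at a time (`abs_trackedMass_succ_sub_le`). A gauge
transformation rewrites the average over (α, β) as an average over frames (g, h), followed by an
average over permutations that fix the points already tracked. For each frame the next value is the
one-path problem on the remaining points. The s errors add up, and the rest is numerical slack. -/

lemma expect_perm_mul_right (f : Perm X → ℝ) (a : Perm X) : 𝔼 b, f (b * a) = 𝔼 b, f b :=
  Fintype.expect_equiv (Equiv.mulRight a) _ _ fun _ => rfl

lemma expect_perm_apply (f : X → ℝ) (z : X) : 𝔼 b : Perm X, f (b z) = 𝔼 x, f x := by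
  have : Nonempty X := ⟨z⟩
  have h : ∀ x, 𝔼 b : Perm X, f (b x) = 𝔼 b : Perm X, f (b z) := fun x => by
    rw [← expect_perm_mul_right (fun b => f (b x)) (swap z x)]
    simp
  calc 𝔼 b : Perm X, f (b z) = 𝔼 x, 𝔼 b : Perm X, f (b x) := by simp [h]
    _ = 𝔼 b : Perm X, 𝔼 x, f (b x) := expect_comm _ _ _
    _ = 𝔼 _b : Perm X, 𝔼 x, f x :=
      expect_congr rfl fun b _ => Fintype.expect_equiv b _ _ fun _ => rfl
    _ = _ := by simp

/-- The kernel of the projection onto the functions with mean zero. -/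
noncomputable def centeredKernel (z z' : X) : ℝ := (if z = z' then 1 else 0) - 1 / Fintype.card X

lemma abs_centeredKernel_le [Nonempty X] (z z' : X) : |centeredKernel z z'| ≤ 1 := by
  have h : (1 : ℝ) ≤ Fintype.card X := by exact_mod_cast Fintype.card_pos
  have h1 : 1 / (Fintype.card X : ℝ) ≤ 1 := by rw [div_le_one (by linarith)]; exact h
  have h0 : 0 ≤ 1 / (Fintype.card X : ℝ) := by positivity
  unfold centeredKernel
  split_ifs <;> rw [abs_le] <;> constructor <;> linarith

/-- The average is invariant under simultaneous permutation of z and z', so it has one value on the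
diagonal and one off it. Vanishing total sum fixes their ratio to be that of `centeredKernel`. -/
lemma expect_perm_apply_apply (f : X → X → ℝ) (hX : 2 ≤ Fintype.card X)
    (hf : ∑ x, ∑ x', f x x' = 0) (z z' : X) :
    𝔼 b : Perm X, f (b z) (b z')
      = (𝔼 x, f x x) * (Fintype.card X / (Fintype.card X - 1)) * centeredKernel z z' := by
  have hn : (2 : ℝ) ≤ Fintype.card X := by exact_mod_cast hX
  have hn1 : (Fintype.card X : ℝ) - 1 ≠ 0 := by linarith
  have hn0 : (Fintype.card X : ℝ) ≠ 0 := by linarith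
  have hdiag := expect_perm_apply (fun x => f x x) z
  by_cases hz : z = z'
  · subst hz
    rw [hdiag]
    simp only [centeredKernel, if_true]
    field_simp
  · have hsym : ∀ x ∈ univ.erase z, 𝔼 b : Perm X, f (b z) (b x) = 𝔼 b : Perm X, f (b z) (b z') := by
      intro x hx
      rw [← expect_perm_mul_right (fun b => f (b z) (b x)) (swap z' x)]
      rw [mem_erase] at hx
      simp [swap_apply_of_ne_of_ne hz hx.1.symm]
    have hall : ∑ x, 𝔼 b : Perm X, f (b z) (b x) = 0 := by
      rw [← expect_sum_comm]
      calc 𝔼 b : Perm X, ∑ x, f (b z) (b x) = 𝔼 b : Perm X, ∑ x, f (b z) x :=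
            expect_congr rfl fun b _ => Equiv.sum_comp b _
        _ = 𝔼 y, ∑ x, f y x := expect_perm_apply (fun y => ∑ x, f y x) z
        _ = 0 := by rw [Fintype.expect_eq_sum_div_card, hf, zero_div]
    rw [← add_sum_erase _ _ (mem_univ z), sum_congr rfl hsym, hdiag, sum_const,
      card_erase_of_mem (mem_univ z), card_univ, nsmul_eq_mul, Nat.cast_sub (by omega)] at hall
    simp only [centeredKernel, if_neg hz]
    push_cast at hall
    field_simp
    linarith

/-- The normalized character `(fix (a⁻¹ a') - 1) / (n - 1)` of the standard representation. -/
noncomputable def stdCorr (a a' : Perm X) : ℝ :=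
  ((univ.filter fun x => a x = a' x).card - 1) / (Fintype.card X - 1)

/-- Schur's lemma for the standard representation: `centeredKernel` is an eigenfunction of the
averaging over b, and the eigenvalue is a normalized trace. -/
lemma expect_centeredKernel (hX : 2 ≤ Fintype.card X) (a a' : Perm X) (z z' : X) :
    𝔼 b : Perm X, centeredKernel (a (b z)) (a' (b z')) = stdCorr a a' * centeredKernel z z' := by
  have hn : (2 : ℝ) ≤ Fintype.card X := by exact_mod_cast hX
  have hn1 : (Fintype.card X : ℝ) - 1 ≠ 0 := by linarith
  have hn0 : (Fintype.card X : ℝ) ≠ 0 := by linarith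
  rw [expect_perm_apply_apply (fun x x' => centeredKernel (a x) (a' x')) hX]
  · rw [Fintype.expect_eq_sum_div_card]
    simp only [centeredKernel, stdCorr, sum_sub_distrib, sum_boole, sum_const, card_univ,
      nsmul_eq_mul]
    field_simp
  · refine sum_eq_zero fun x _ => ?_
    rw [Equiv.sum_comp a' (fun y => centeredKernel (a x) y)]
    simp [centeredKernel, hn0]

/-- Averaging over the last β turns the two centered indicators into `centeredKernel` at the current
endpoints z, z'. This is the entry point for the recursion on the remaining factors. -/
lemma expect_indicator_mul_indicator (hX : 2 ≤ Fintype.card X) (a a' : Perm X) (y z z' : X) :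
    𝔼 b : Perm X, ((Fintype.card X : ℝ) * (if a (b z) = y then 1 else 0) - 1)
        * ((Fintype.card X : ℝ) * (if a' (b z') = y then 1 else 0) - 1)
      = centeredKernel (a⁻¹ y) (a'⁻¹ y) * (Fintype.card X ^ 2 / (Fintype.card X - 1))
        * centeredKernel z z' := by
  have hn : (2 : ℝ) ≤ Fintype.card X := by exact_mod_cast hX
  have hn1 : (Fintype.card X : ℝ) - 1 ≠ 0 := by linarith
  have hn0 : (Fintype.card X : ℝ) ≠ 0 := by linarith
  have hsum : ∀ a : Perm X, ∑ x, (if a x = y then (1 : ℝ) else 0) = 1 := fun a => by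
    simp [← Perm.eq_inv_iff_eq]
  have hprod : ∑ x, (if a x = y then (1 : ℝ) else 0) * (if a' x = y then 1 else 0)
      = if a⁻¹ y = a'⁻¹ y then 1 else 0 := by
    simp only [← Perm.eq_inv_iff_eq, ite_mul, one_mul, zero_mul, sum_ite_eq', mem_univ, if_true]
  rw [expect_perm_apply_apply (fun x x' => ((Fintype.card X : ℝ) * (if a x = y then 1 else 0) - 1)
        * ((Fintype.card X : ℝ) * (if a' x' = y then 1 else 0) - 1)) hX]
  · have h : ∑ x, ((Fintype.card X : ℝ) * (if a x = y then 1 else 0) - 1)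
        * ((Fintype.card X : ℝ) * (if a' x = y then 1 else 0) - 1)
        = Fintype.card X ^ 2 * centeredKernel (a⁻¹ y) (a'⁻¹ y) := by
      calc _ = (Fintype.card X : ℝ) ^ 2 * ∑ x, (if a x = y then (1 : ℝ) else 0)
              * (if a' x = y then 1 else 0)
            - Fintype.card X * ∑ x, (if a x = y then (1 : ℝ) else 0)
            - Fintype.card X * ∑ x, (if a' x = y then (1 : ℝ) else 0) + ∑ _x : X, 1 := by
            rw [mul_sum, mul_sum, mul_sum, ← sum_sub_distrib, ← sum_sub_distrib,
              ← sum_add_distrib]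
            exact sum_congr rfl fun x _ => by ring
        _ = _ := by
            rw [hprod, hsum, hsum]
            simp only [centeredKernel, sum_const, card_univ, nsmul_eq_mul]
            field_simp
            ring
    rw [Fintype.expect_eq_sum_div_card, h]
    field_simp
  · refine sum_eq_zero fun x _ => ?_
    rw [← mul_sum, sum_sub_distrib, ← mul_sum, hsum]
    simp

end PermAverage

/-! ### Alternating products -/

/-- The product `α_{c-1} β_{c-1} ⋯ α_0 β_0`. -/
def altProd {G : Type*} [Group G] : (c : ℕ) → (Fin c → G) → (Fin c → G) → G
  | 0, _, _ => 1
  | c + 1, α, β => α (Fin.last c) * β (Fin.last c)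
      * altProd c (fun i => α i.castSucc) (fun i => β i.castSucc)

lemma expect_fin_succ {G : Type*} [Fintype G] {d : ℕ} (f : (Fin (d + 1) → G) → ℝ) :
    𝔼 β, f β = 𝔼 β : Fin d → G, 𝔼 b : G, f (Fin.snoc β b) := by
  rw [expect_comm, ← expect_product' univ univ fun b (β : Fin d → G) =>
    f (Fin.snoc (α := fun _ => G) β b)]
  exact (Fintype.expect_equiv (Fin.snocEquiv fun _ => G) _ _ fun _ => rfl).symm

section Correlation

variable {X : Type*} [Fintype X] [DecidableEq X]

/-- Averaging over the β factors from the last to the first, each one releases one eigenvalue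
`stdCorr`. -/
lemma expect_centeredKernel_altProd (hX : 2 ≤ Fintype.card X) (d : ℕ) (α α' : Fin d → Perm X)
    (x x' : X) :
    𝔼 β, centeredKernel (altProd d α β x) (altProd d α' β x')
      = (∏ i, stdCorr (α i) (α' i)) * centeredKernel x x' := by
  induction d with
  | zero => simp [altProd]
  | succ d ih =>
    rw [expect_fin_succ]
    simp only [altProd, Fin.snoc_last, Fin.snoc_castSucc, Perm.mul_apply,
      expect_centeredKernel hX]
    rw [← mul_expect, ih, Fin.prod_univ_castSucc]
    ring

/-- The correlation of two alternating products with common `β`. -/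
lemma expect_altProd_correlation_le (hX : 2 ≤ Fintype.card X) (d : ℕ)
    (α α' : Fin (d + 1) → Perm X) (x y : X) :
    𝔼 β, ((Fintype.card X : ℝ) * (if altProd (d + 1) α β x = y then 1 else 0) - 1)
        * ((Fintype.card X : ℝ) * (if altProd (d + 1) α' β x = y then 1 else 0) - 1)
      ≤ Fintype.card X * ∏ i : Fin d, |stdCorr (α i.castSucc) (α' i.castSucc)| := by
  have hn : (2 : ℝ) ≤ Fintype.card X := by exact_mod_cast hX
  have hn1 : (Fintype.card X : ℝ) - 1 ≠ 0 := by linarith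
  have hn0 : (Fintype.card X : ℝ) ≠ 0 := by linarith
  have : Nonempty X := ⟨x⟩
  rw [expect_fin_succ]
  simp only [altProd, Fin.snoc_last, Fin.snoc_castSucc, Perm.mul_apply,
    expect_indicator_mul_indicator hX]
  rw [← mul_expect, expect_centeredKernel_altProd hX, ← abs_prod]
  have hxx : centeredKernel x x = (Fintype.card X - 1) / (Fintype.card X : ℝ) := by
    simp only [centeredKernel, if_true]; field_simp
  rw [hxx]
  set K := centeredKernel ((α (Fin.last d))⁻¹ y) ((α' (Fin.last d))⁻¹ y) with hK
  set P := ∏ i : Fin d, stdCorr (α i.castSucc) (α' i.castSucc)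
  have e : K * ((Fintype.card X : ℝ) ^ 2 / (Fintype.card X - 1))
      * (P * ((Fintype.card X - 1) / (Fintype.card X : ℝ))) = Fintype.card X * (K * P) := by
    field_simp
  rw [e]
  refine mul_le_mul_of_nonneg_left ?_ (by linarith)
  refine (le_abs_self _).trans ?_
  rw [abs_mul]
  -- The last α enters only through K, which is merely bounded by 1; hence d decaying factors out of
  -- d + 1.
  exact mul_le_of_le_one_left (abs_nonneg _) (abs_centeredKernel_le _ _)

end Correlation

/-! ### Moments of the number of fixed points -/

/-- The number of fixed points of a permutation. -/
def fixCount {X : Type*} [Fintype X] [DecidableEq X] (π : Perm X) : ℕ :=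
  (univ.filter fun x => π x = x).card

lemma fixCount_ofSubtype {X : Type*} [Fintype X] [DecidableEq X] (x : X)
    (π : Perm {y : X // y ≠ x}) :
    fixCount (Perm.ofSubtype π) = fixCount π + 1 := by
  unfold fixCount
  have h : (univ.filter fun z => Perm.ofSubtype π z = z)
      = insert x ((univ.filter fun z => π z = z).map (Function.Embedding.subtype _)) := by
    ext z
    simp only [mem_filter, mem_univ, true_and, mem_insert, mem_map, Function.Embedding.subtype_apply]
    by_cases hz : z = x
    · subst hz
      simp [Perm.ofSubtype_apply_of_not_mem]
    · rw [Perm.ofSubtype_apply_of_mem π hz]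
      simp only [hz, false_or]
      constructor
      · intro h
        exact ⟨⟨z, hz⟩, Subtype.ext h, rfl⟩
      · rintro ⟨w, hw, rfl⟩
        exact congrArg Subtype.val hw
  rw [h, card_insert_of_notMem, card_map]
  simp

lemma sum_perm_fixing {X : Type*} [Fintype X] [DecidableEq X] (x : X) (g : Perm X → ℝ) :
    ∑ π : Perm X, (if π x = x then g π else 0)
      = ∑ π : Perm {y : X // y ≠ x}, g (Perm.ofSubtype π) := by
  rw [← sum_filter]
  symm
  refine sum_bij (fun π _ => Perm.ofSubtype π) ?_ ?_ ?_ ?_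
  · intro π _
    simp [Perm.ofSubtype_apply_of_not_mem]
  · intro π _ π' _ h
    exact Perm.ofSubtype_injective h
  · intro π hπ
    rw [mem_filter] at hπ
    refine ⟨((Perm.subtypeEquivSubtypePerm (fun y => y ≠ x)).symm ⟨π, fun a ha => ?_⟩), mem_univ _, ?_⟩
    · rw [not_not.1 ha]; exact hπ.2
    · have := Equiv.apply_symm_apply (Perm.subtypeEquivSubtypePerm (fun y => y ≠ x))
        ⟨π, fun a ha => by rw [not_not.1 ha]; exact hπ.2⟩
      exact congrArg Subtype.val this
  · intro π _
    rfl

/-- One factor k + fix is expanded as k plus a sum over fixed points x. The permutations fixing x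
are those of the other points, with one fixed point fewer, so k becomes k + 1; the shift k is there
for this induction on p. -/
lemma sum_fixCount_pow_le {X : Type*} [Fintype X] [DecidableEq X] (p k : ℕ) :
    ∑ π : Perm X, ((k : ℝ) + fixCount π) ^ p ≤ (Fintype.card X).factorial * ((k : ℝ) + p) ^ p := by
  induction p generalizing X k with
  | zero => simp [Fintype.card_perm]
  | succ p ih =>
    have hsplit : ∑ π : Perm X, ((k : ℝ) + fixCount π) ^ (p + 1)
        = k * ∑ π : Perm X, ((k : ℝ) + fixCount π) ^ p
          + ∑ x : X, ∑ π : Perm {y : X // y ≠ x}, (((k + 1 : ℕ) : ℝ) + fixCount π) ^ p := by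
      have h : ∀ x : X, ∑ π : Perm {y : X // y ≠ x}, (((k + 1 : ℕ) : ℝ) + fixCount π) ^ p
          = ∑ π : Perm X, if π x = x then ((k : ℝ) + fixCount π) ^ p else 0 := fun x => by
        rw [sum_perm_fixing x fun π => ((k : ℝ) + fixCount π) ^ p]
        refine sum_congr rfl fun π _ => ?_
        rw [fixCount_ofSubtype]
        push_cast
        ring
      rw [sum_congr rfl fun x _ => h x, sum_comm, mul_sum, ← sum_add_distrib]
      refine sum_congr rfl fun π _ => ?_
      rw [← sum_filter, sum_const, nsmul_eq_mul, ← fixCount]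
      ring
    have h2 : ∑ x : X, ∑ π : Perm {y : X // y ≠ x}, (((k + 1 : ℕ) : ℝ) + fixCount π) ^ p
        ≤ (Fintype.card X).factorial * ((k : ℝ) + (p + 1)) ^ p := by
      rcases isEmpty_or_nonempty X with hX | hX
      · simp only [univ_eq_empty, sum_empty]; positivity
      calc _ ≤ ∑ _x : X, ((Fintype.card X - 1).factorial : ℝ) * ((k : ℝ) + (p + 1)) ^ p := by
            refine sum_le_sum fun x _ => ?_
            have h3 := ih (X := {y : X // y ≠ x}) (k + 1)
            have hcard : Fintype.card {y : X // y ≠ x} = Fintype.card X - 1 := by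
              simp [Fintype.card_subtype_compl]
            rw [hcard] at h3
            refine h3.trans (le_of_eq ?_)
            push_cast
            ring
        _ = _ := by
            rw [sum_const, card_univ, nsmul_eq_mul, ← mul_assoc, ← Nat.cast_mul,
              Nat.mul_factorial_pred Fintype.card_ne_zero]
    rw [hsplit]
    have h1 := mul_le_mul_of_nonneg_left (ih (X := X) k) (Nat.cast_nonneg (α := ℝ) k)
    have h4 : ((k : ℝ) + p) ^ p ≤ ((k : ℝ) + (p + 1)) ^ p := by gcongr; linarith
    have hf : (0 : ℝ) ≤ (Fintype.card X).factorial := by positivity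
    have hb : (0 : ℝ) ≤ ((k : ℝ) + (p + 1)) ^ p := by positivity
    calc _ ≤ (k : ℝ) * ((Fintype.card X).factorial * ((k : ℝ) + (p + 1)) ^ p)
          + (Fintype.card X).factorial * ((k : ℝ) + (p + 1)) ^ p := by
          refine add_le_add (h1.trans ?_) h2
          gcongr
      _ = (Fintype.card X).factorial * (((k : ℝ) + 1) * ((k : ℝ) + (p + 1)) ^ p) := by ring
      _ ≤ _ := by
          refine mul_le_mul_of_nonneg_left ?_ hf
          rw [pow_succ']
          push_cast
          refine mul_le_mul_of_nonneg_right ?_ hb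
          have : (0 : ℝ) ≤ p := Nat.cast_nonneg p
          linarith

section Moments

variable {X : Type*} [Fintype X] [DecidableEq X]

/-- The permutation a'⁻¹a is uniform, and |fix - 1| ≤ 1 + fix, so this is the moment bound with
shift k = 1. -/
lemma expect_abs_stdCorr_pow_le (hX : 2 ≤ Fintype.card X) (a' : Perm X) (p : ℕ) :
    𝔼 a, |stdCorr a a'| ^ p ≤ (((p : ℝ) + 1) / (Fintype.card X - 1)) ^ p := by
  have hn : (2 : ℝ) ≤ Fintype.card X := by exact_mod_cast hX
  have hn1 : (0 : ℝ) < Fintype.card X - 1 := by linarith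
  have h1 : 𝔼 a, |stdCorr a a'| ^ p = 𝔼 π : Perm X, |((fixCount π : ℝ) - 1) / (Fintype.card X - 1)| ^ p := by
    refine Fintype.expect_equiv (Equiv.mulLeft a'⁻¹) _ _ fun a => ?_
    have : fixCount (a'⁻¹ * a) = (univ.filter fun x => a x = a' x).card := by
      unfold fixCount
      congr 1
      ext x
      simp only [mem_filter, mem_univ, true_and, Perm.mul_apply, Perm.inv_eq_iff_eq]
    simp only [Equiv.coe_mulLeft, this, stdCorr]
  rw [h1, Fintype.expect_eq_sum_div_card, Fintype.card_perm,
    div_le_iff₀ (by exact_mod_cast Nat.factorial_pos _), div_pow]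
  calc ∑ π : Perm X, |((fixCount π : ℝ) - 1) / (Fintype.card X - 1)| ^ p
      ≤ ∑ π : Perm X, (((1 : ℕ) : ℝ) + fixCount π) ^ p / ((Fintype.card X : ℝ) - 1) ^ p := by
        refine sum_le_sum fun π _ => ?_
        rw [abs_div, abs_of_pos hn1, div_pow]
        gcongr
        have : (0 : ℝ) ≤ fixCount π := Nat.cast_nonneg _
        rw [abs_le]
        push_cast
        constructor <;> linarith
    _ = (∑ π : Perm X, (((1 : ℕ) : ℝ) + fixCount π) ^ p) / ((Fintype.card X : ℝ) - 1) ^ p := by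
        rw [sum_div]
    _ ≤ ((Fintype.card X).factorial * (((1 : ℕ) : ℝ) + p) ^ p) / ((Fintype.card X : ℝ) - 1) ^ p := by
        gcongr
        exact sum_fixCount_pow_le p 1
    _ = _ := by
        push_cast
        ring

lemma expect_prod_abs_stdCorr_pow_le (hX : 2 ≤ Fintype.card X) (p d : ℕ) (α' : Fin d → Perm X) :
    𝔼 α : Fin d → Perm X, (∏ i, |stdCorr (α i) (α' i)|) ^ p
      ≤ ((((p : ℝ) + 1) / (Fintype.card X - 1)) ^ d) ^ p := by
  have hn : (2 : ℝ) ≤ Fintype.card X := by exact_mod_cast hX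
  have hn1 : (0 : ℝ) < Fintype.card X - 1 := by linarith
  induction d with
  | zero => simp
  | succ d ih =>
    rw [expect_fin_succ]
    simp only [Fin.prod_univ_castSucc, Fin.snoc_last, Fin.snoc_castSucc, mul_pow]
    simp only [← mul_expect]
    rw [← expect_mul, pow_succ (((p : ℝ) + 1) / (Fintype.card X - 1)) d, mul_pow]
    refine mul_le_mul (ih _) (expect_abs_stdCorr_pow_le hX _ p) ?_ (by positivity)
    exact expect_nonneg fun _ _ => by positivity

/-- A set of density `P` cannot have a large average correlation. -/
lemma expect_mul_prod_abs_stdCorr_le (hX : 2 ≤ Fintype.card X) (C d : ℕ)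
    (w : (Fin (d + 1) → Perm X) → ℝ) (hw0 : ∀ α, 0 ≤ w α) (hw1 : ∀ α, w α ≤ 1)
    (α' : Fin (d + 1) → Perm X) :
    𝔼 α, w α * ∏ i : Fin d, |stdCorr (α i.castSucc) (α' i.castSucc)|
      ≤ (((C : ℝ) + 2) / (Fintype.card X - 1)) ^ d * (3 * (𝔼 α, w α) + 1 / 3 ^ C) := by
  have hn : (2 : ℝ) ≤ Fintype.card X := by exact_mod_cast hX
  have hn1 : (0 : ℝ) < Fintype.card X - 1 := by linarith
  set Q : ℝ := (((C : ℝ) + 2) / (Fintype.card X - 1)) ^ d with hQ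
  have hQ0 : 0 < Q := by positivity
  set Ψ : (Fin (d + 1) → Perm X) → ℝ :=
    fun α => ∏ i : Fin d, |stdCorr (α i.castSucc) (α' i.castSucc)| with hΨ
  have hΨ0 : ∀ α, 0 ≤ Ψ α := fun α => prod_nonneg fun _ _ => abs_nonneg _
  have hmom : 𝔼 α, Ψ α ^ (C + 1) ≤ Q ^ (C + 1) := by
    -- Ψ does not involve the last α, which is averaged out first.
    rw [expect_fin_succ]
    simp only [hΨ, Fin.snoc_castSucc, Fintype.expect_const]
    refine (expect_prod_abs_stdCorr_pow_le hX (C + 1) d fun i => α' i.castSucc).trans (le_of_eq ?_)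
    rw [hQ]
    push_cast
    ring
  -- Truncation at 3Q: below it Ψ is replaced by 3Q, above it w is dropped and Ψ ≤ Ψ (Ψ/(3Q))^C.
  have hpt : ∀ α, w α * Ψ α ≤ w α * (3 * Q) + Ψ α ^ (C + 1) * (1 / (3 * Q) ^ C) := by
    intro α
    rcases le_total (Ψ α) (3 * Q) with h | h
    · have := mul_le_mul_of_nonneg_left h (hw0 α)
      have h2 : 0 ≤ Ψ α ^ (C + 1) * (1 / (3 * Q) ^ C) := by have := hΨ0 α; positivity
      linarith
    · have h1 : w α * Ψ α ≤ Ψ α := mul_le_of_le_one_left (hΨ0 α) (hw1 α)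
      have h2 : 0 ≤ w α * (3 * Q) := mul_nonneg (hw0 α) (by positivity)
      have h3 : Ψ α ≤ Ψ α ^ (C + 1) * (1 / (3 * Q) ^ C) := by
        rw [mul_one_div, le_div_iff₀ (by positivity), pow_succ']
        exact mul_le_mul_of_nonneg_left (pow_le_pow_left₀ (by positivity) h C) (hΨ0 α)
      linarith
  calc 𝔼 α, w α * Ψ α ≤ 𝔼 α, (w α * (3 * Q) + Ψ α ^ (C + 1) * (1 / (3 * Q) ^ C)) :=
        expect_le_expect fun α _ => hpt α
    _ = (𝔼 α, w α) * (3 * Q) + (𝔼 α, Ψ α ^ (C + 1)) * (1 / (3 * Q) ^ C) := by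
        rw [expect_add_distrib, expect_mul, expect_mul]
    _ ≤ (𝔼 α, w α) * (3 * Q) + Q ^ (C + 1) * (1 / (3 * Q) ^ C) := by
        gcongr
    _ = _ := by
        rw [mul_pow]
        field_simp
        ring

end Moments

/-! ### One tracked path -/

section OnePath

variable {X : Type*} [Fintype X] [DecidableEq X]

lemma sq_expect_abs_le {ι : Type*} [Fintype ι] [Nonempty ι] (f : ι → ℝ) :
    (𝔼 i, |f i|) ^ 2 ≤ 𝔼 i, f i ^ 2 := by
  have := expect_mul_sq_le_sq_mul_sq univ (fun i => |f i|) fun _ => (1 : ℝ)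
  simpa using this

/-- For an event of Alice of density `P = 𝔼 w`, the part of it on which the path from `x` ends
in `y` has nearly the expected density, for most choices of `β`. -/
lemma expect_abs_expect_mul_le (hX : 2 ≤ Fintype.card X) (C d : ℕ)
    (w : (Fin (d + 1) → Perm X) → ℝ) (hw0 : ∀ α, 0 ≤ w α) (hw1 : ∀ α, w α ≤ 1) (x y : X) :
    𝔼 β, |𝔼 α, w α * ((Fintype.card X : ℝ) * (if altProd (d + 1) α β x = y then 1 else 0) - 1)|
      ≤ √(Fintype.card X * (((C : ℝ) + 2) / (Fintype.card X - 1)) ^ d)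
        * (7 / 4 * (𝔼 α, w α) + 1 / 4 * (1 / 3 ^ C)) := by
  have hn : (2 : ℝ) ≤ Fintype.card X := by exact_mod_cast hX
  have hn1 : (0 : ℝ) < Fintype.card X - 1 := by linarith
  set n : ℝ := (Fintype.card X : ℝ) with hndef
  set Q : ℝ := (((C : ℝ) + 2) / (n - 1)) ^ d with hQ
  have hQ0 : 0 < Q := by positivity
  set D : (Fin (d + 1) → Perm X) → (Fin (d + 1) → Perm X) → ℝ :=
    fun α β => n * (if altProd (d + 1) α β x = y then 1 else 0) - 1 with hD
  set p : ℝ := 𝔼 α, w α with hp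
  have hp0 : 0 ≤ p := expect_nonneg fun α _ => hw0 α
  set ε : ℝ := 1 / 3 ^ C with hε
  have hε0 : 0 ≤ ε := by positivity
  -- The square is expanded with an independent copy α' of α under the same β, and the average over
  -- β is taken first.
  have hsecond : 𝔼 β, (𝔼 α, w α * D α β) ^ 2 ≤ n * Q * (p * (3 * p + ε)) := by
    calc 𝔼 β, (𝔼 α, w α * D α β) ^ 2
        = 𝔼 β, 𝔼 α', 𝔼 α, w α' * (w α * (D α β * D α' β)) := by
          refine expect_congr rfl fun β _ => ?_
          rw [sq, expect_mul_expect, expect_comm]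
          refine expect_congr rfl fun α' _ => expect_congr rfl fun α _ => by ring
      _ = 𝔼 α', w α' * 𝔼 α, w α * 𝔼 β, D α β * D α' β := by
          rw [expect_comm]
          refine expect_congr rfl fun α' _ => ?_
          rw [expect_comm, mul_expect]
          refine expect_congr rfl fun α _ => ?_
          rw [mul_expect, mul_expect]
      _ ≤ 𝔼 α', w α' * (n * (Q * (3 * p + ε))) := by
          refine expect_le_expect fun α' _ => mul_le_mul_of_nonneg_left ?_ (hw0 α')
          calc 𝔼 α, w α * 𝔼 β, D α β * D α' β
              ≤ 𝔼 α, w α * (n * ∏ i : Fin d, |stdCorr (α i.castSucc) (α' i.castSucc)|) :=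
                expect_le_expect fun α _ => mul_le_mul_of_nonneg_left
                  (expect_altProd_correlation_le hX d α α' x y) (hw0 α)
            _ = n * 𝔼 α, w α * ∏ i : Fin d, |stdCorr (α i.castSucc) (α' i.castSucc)| := by
                rw [mul_expect]
                exact expect_congr rfl fun α _ => by ring
            _ ≤ _ := mul_le_mul_of_nonneg_left
                (expect_mul_prod_abs_stdCorr_le hX C d w hw0 hw1 α') (by linarith)
      _ = _ := by rw [← expect_mul]; ring
  have hnn : 0 ≤ √(n * Q) * (7 / 4 * p + 1 / 4 * ε) := by positivity
  refine abs_le_of_sq_le_sq' ?_ hnn |>.2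
  refine (sq_expect_abs_le _).trans (hsecond.trans ?_)
  rw [mul_pow, Real.sq_sqrt (by positivity)]
  refine mul_le_mul_of_nonneg_left ?_ (by positivity)
  -- This is the identity (7p/4 + ε/4)² = p(3p + ε) + (p - ε)²/16.
  nlinarith [sq_nonneg (p - ε)]

/-- A short message about `α` together with `β` hardly tells where the path from `x` ends. -/
theorem abs_expect_onePath_le (hX : 2 ≤ Fintype.card X) (C d : ℕ) {Msg : Type*} [Fintype Msg]
    [DecidableEq Msg] (hMsg : Fintype.card Msg ≤ 3 ^ C) (m : (Fin (d + 1) → Perm X) → Msg)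
    (t : Msg → (Fin (d + 1) → Perm X) → ℝ) (ht : ∀ μ β, |t μ β| ≤ 1) (x y : X) :
    |𝔼 α, 𝔼 β, t (m α) β
        * ((Fintype.card X : ℝ) * (if altProd (d + 1) α β x = y then 1 else 0) - 1)|
      ≤ 2 * √(Fintype.card X * (((C : ℝ) + 2) / (Fintype.card X - 1)) ^ d) := by
  set n : ℝ := (Fintype.card X : ℝ) with hndef
  set R : ℝ := √(n * (((C : ℝ) + 2) / (n - 1)) ^ d) with hR
  set D : (Fin (d + 1) → Perm X) → (Fin (d + 1) → Perm X) → ℝ :=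
    fun α β => n * (if altProd (d + 1) α β x = y then 1 else 0) - 1 with hD
  set w : Msg → (Fin (d + 1) → Perm X) → ℝ := fun μ α => if m α = μ then 1 else 0 with hw
  have hw0 : ∀ μ α, 0 ≤ w μ α := fun μ α => by simp only [hw]; split_ifs <;> norm_num
  have hw1 : ∀ μ α, w μ α ≤ 1 := fun μ α => by simp only [hw]; split_ifs <;> norm_num
  have hwsum : ∑ μ, 𝔼 α, w μ α = 1 := by
    rw [← expect_sum_comm]
    simp [hw]
  have key : 𝔼 α, 𝔼 β, t (m α) β * D α β = ∑ μ, 𝔼 β, t μ β * 𝔼 α, w μ α * D α β := by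
    calc 𝔼 α, 𝔼 β, t (m α) β * D α β = 𝔼 α, 𝔼 β, ∑ μ, t μ β * (w μ α * D α β) := by
          refine expect_congr rfl fun α _ => expect_congr rfl fun β _ => ?_
          simp [hw]
      _ = ∑ μ, 𝔼 α, 𝔼 β, t μ β * (w μ α * D α β) := by
          simp only [expect_sum_comm]
      _ = _ := by
          refine sum_congr rfl fun μ _ => ?_
          rw [expect_comm]
          simp only [mul_expect]
  rw [key]
  calc |∑ μ, 𝔼 β, t μ β * 𝔼 α, w μ α * D α β|
      ≤ ∑ μ, 𝔼 β, |𝔼 α, w μ α * D α β| := by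
        refine (abs_sum_le_sum_abs _ _).trans (sum_le_sum fun μ _ => ?_)
        refine (abs_expect_le _ _).trans (expect_le_expect fun β _ => ?_)
        rw [abs_mul]
        exact mul_le_of_le_one_left (abs_nonneg _) (ht μ β)
    -- The densities of the messages sum to 1 and there are at most 3^C messages, so the total
    -- weight is at most 7/4 + 1/4 = 2.
    _ ≤ ∑ μ, R * (7 / 4 * (𝔼 α, w μ α) + 1 / 4 * (1 / 3 ^ C)) :=
        sum_le_sum fun μ _ => expect_abs_expect_mul_le hX C d (w μ) (hw0 μ) (hw1 μ) x y
    _ = R * (7 / 4 + 1 / 4 * (Fintype.card Msg / 3 ^ C)) := by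
        rw [← mul_sum, sum_add_distrib, ← mul_sum, hwsum]
        simp only [sum_const, card_univ, nsmul_eq_mul]
        ring
    _ ≤ R * 2 := by
        have : (Fintype.card Msg : ℝ) / 3 ^ C ≤ 1 := by
          rw [div_le_one (by positivity)]
          exact_mod_cast hMsg
        refine mul_le_mul_of_nonneg_left (by linarith) (Real.sqrt_nonneg _)
    _ = 2 * R := mul_comm _ _

end OnePath

/-! ### Gauge transformations -/

section Gauge

variable {G : Type*} [Group G]

/-- The factors `α_i` after a change of coordinates by `h_i` at their source and by `g_i` at their
target. -/
def gaugeLeft {c : ℕ} (g h a : Fin c → G) (i : Fin c) : G := g i * a i * (h i)⁻¹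

/-- The factors `β_i` after a change of coordinates by `g_{i-1}` at their source (`1` if `i = 0`)
and by `h_i` at their target. -/
def gaugeRight {c : ℕ} (g h b : Fin c → G) (i : Fin c) : G :=
  h i * b i * ((Fin.cons 1 g : Fin (c + 1) → G) i.castSucc)⁻¹

lemma cons_one_castSucc {c : ℕ} (g : Fin (c + 1) → G) (i : Fin (c + 1)) :
    (Fin.cons 1 g : Fin (c + 2) → G) i.castSucc
      = (Fin.cons 1 (fun i : Fin c => g i.castSucc) : Fin (c + 1) → G) i := by
  induction i using Fin.cases with
  | zero => rfl
  | succ i => rw [← Fin.succ_castSucc, Fin.cons_succ, Fin.cons_succ]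

/-- The inner changes of coordinates cancel telescopically. The source of the first factor is not
changed, so only the last g survives. -/
lemma altProd_gauge (c : ℕ) (g h a b : Fin c → G) :
    altProd c (gaugeLeft g h a) (gaugeRight g h b)
      = (Fin.cons 1 g : Fin (c + 1) → G) (Fin.last c) * altProd c a b := by
  induction c with
  | zero => simp [altProd]
  | succ c ih =>
    have hl : (fun i : Fin c => gaugeLeft g h a i.castSucc)
        = gaugeLeft (fun i => g i.castSucc) (fun i => h i.castSucc) (fun i => a i.castSucc) := rfl
    have hr : (fun i : Fin c => gaugeRight g h b i.castSucc)
        = gaugeRight (fun i => g i.castSucc) (fun i => h i.castSucc) (fun i => b i.castSucc) := by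
      funext i
      simp only [gaugeRight, cons_one_castSucc]
    have hlast : (Fin.cons 1 g : Fin (c + 2) → G) (Fin.last (c + 1)) = g (Fin.last c) := by
      rw [← Fin.succ_last, Fin.cons_succ]
    simp only [altProd]
    rw [hl, hr, ih, hlast]
    simp only [gaugeLeft, gaugeRight, cons_one_castSucc]
    group

/-- The frames can be recovered in the order h_0, g_0, h_1, g_1, …, since each transformed factor
contains just one frame not yet known. -/
lemma gauge_injective {c : ℕ} (a b : Fin c → G) :
    Function.Injective fun p : (Fin c → G) × (Fin c → G) =>
      (gaugeLeft p.1 p.2 a, gaugeRight p.1 p.2 b) := by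
  rintro ⟨g, h⟩ ⟨g', h'⟩ heq
  simp only [Prod.mk.injEq] at heq
  have hstep : ∀ i : Fin c, (Fin.cons 1 g : Fin (c + 1) → G) i.castSucc
      = (Fin.cons 1 g' : Fin (c + 1) → G) i.castSucc → h i = h' i ∧ g i = g' i := by
    intro i hi
    have hb := congrFun heq.2 i
    have ha := congrFun heq.1 i
    simp only [gaugeLeft, gaugeRight, hi, mul_left_inj] at ha hb
    rw [hb] at ha
    simp only [mul_left_inj] at ha
    exact ⟨hb, ha⟩
  have hall : ∀ i : Fin (c + 1), (Fin.cons 1 g : Fin (c + 1) → G) i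
      = (Fin.cons 1 g' : Fin (c + 1) → G) i := by
    intro i
    induction i using Fin.induction with
    | zero => rfl
    | succ i ih => simpa using (hstep i ih).2
  simp only [Prod.mk.injEq]
  exact ⟨funext fun i => (hstep i (hall _)).2, funext fun i => (hstep i (hall _)).1⟩

/-- For any fixed base point (a, b) the map from frames to configurations is an injection between
sets of equal size, so uniform frames yield a uniform configuration. -/
lemma expect_gauge [Fintype G] {c : ℕ} (a b : Fin c → G)
    (f : (Fin c → G) → (Fin c → G) → ℝ) :
    𝔼 α, 𝔼 β, f α β = 𝔼 g, 𝔼 h, f (gaugeLeft g h a) (gaugeRight g h b) := by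
  rw [← expect_product' univ univ f,
    ← expect_product' univ univ fun g h => f (gaugeLeft g h a) (gaugeRight g h b)]
  exact (Fintype.expect_bijective _ (Finite.injective_iff_bijective.1 (gauge_injective a b)) _ _
    fun _ => rfl).symm

lemma altProd_map {H : Type*} [Group H] (φ : H →* G) (c : ℕ) (a b : Fin c → H) :
    altProd c (fun i => φ (a i)) (fun i => φ (b i)) = φ (altProd c a b) := by
  induction c with
  | zero => simp [altProd]
  | succ c ih => simp [altProd, ih]

end Gauge

/-! ### Tracking several paths -/

section Paths

variable {V : Type*} {s : ℕ}

/-- The first `k` prescribed values `u_i ↦ v_i` are taken by `σ`. -/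
def Tracks (u v : Fin s ↪ V) (k : ℕ) (σ : Perm V) : Prop := ∀ i : Fin s, (i : ℕ) < k → σ (u i) = v i

instance [DecidableEq V] (u v : Fin s ↪ V) (k : ℕ) (σ : Perm V) : Decidable (Tracks u v k σ) :=
  inferInstanceAs (Decidable (∀ i : Fin s, (i : ℕ) < k → σ (u i) = v i))

/-- The points off the first `k` tracked paths. -/
abbrev Untracked (u : Fin s ↪ V) (k : ℕ) : Type _ := {y : V // ∀ i : Fin s, (i : ℕ) < k → u i ≠ y}

lemma card_untracked [Fintype V] [DecidableEq V] (u : Fin s ↪ V) (k : ℕ) (hk : k ≤ s) :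
    Fintype.card (Untracked u k) = Fintype.card V - k := by
  have h : Fintype.card {y : V // ¬ ∃ i : Fin s, (i : ℕ) < k ∧ u i = y} = Fintype.card V - k := by
    rw [Fintype.card_subtype_compl]
    congr 1
    rw [Fintype.card_subtype]
    have : (univ.filter fun y : V => ∃ i : Fin s, (i : ℕ) < k ∧ u i = y)
        = (univ.filter fun i : Fin s => (i : ℕ) < k).map u := by
      ext y; simp
    rw [this, card_map, Fin.card_filter_val_lt, min_eq_right hk]
  rw [← h]
  exact Fintype.card_congr (Equiv.subtypeEquivRight fun y => by simp)

lemma tracks_mul_ofSubtype [DecidableEq V] (u v : Fin s ↪ V) (k : ℕ) (γ : Perm V) (τ : Perm (Untracked u k)) :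
    Tracks u v k (γ * Perm.ofSubtype τ) ↔ Tracks u v k γ := by
  refine forall₂_congr fun i hi => ?_
  rw [Perm.mul_apply, Perm.ofSubtype_apply_of_not_mem]
  exact fun h => h i hi rfl

lemma Tracks.inv_apply_ne {u v : Fin s ↪ V} {k : ℕ} {γ : Perm V} (hγ : Tracks u v k γ)
    (hk : k < s) (i : Fin s) (hi : (i : ℕ) < k) : u i ≠ γ⁻¹ (v ⟨k, hk⟩) := by
  intro h
  rw [Perm.eq_inv_iff_eq, hγ i hi] at h
  have := congrArg Fin.val (v.injective h)
  simp only at this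
  omega

lemma ne_of_val_lt (u : Fin s ↪ V) {k : ℕ} (hk : k < s) (i : Fin s) (hi : (i : ℕ) < k) :
    u i ≠ u ⟨k, hk⟩ := by
  intro h
  have := congrArg Fin.val (u.injective h)
  simp only at this
  omega

/-- Once γ tracks k values, the next condition concerns τ alone: it is a single prescribed value on
the untracked points. -/
lemma tracks_succ_mul_ofSubtype [DecidableEq V] {u v : Fin s ↪ V} {k : ℕ} {γ : Perm V} (hγ : Tracks u v k γ)
    (hk : k < s) (τ : Perm (Untracked u k)) :
    Tracks u v (k + 1) (γ * Perm.ofSubtype τ)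
      ↔ τ ⟨u ⟨k, hk⟩, ne_of_val_lt u hk⟩ = ⟨γ⁻¹ (v ⟨k, hk⟩), hγ.inv_apply_ne hk⟩ := by
  have h1 : Tracks u v (k + 1) (γ * Perm.ofSubtype τ)
      ↔ (γ * Perm.ofSubtype τ) (u ⟨k, hk⟩) = v ⟨k, hk⟩ := by
    constructor
    · intro h
      exact h ⟨k, hk⟩ (Nat.lt_succ_self k)
    · intro h i hi
      rcases Nat.lt_succ_iff_lt_or_eq.1 hi with hi | hi
      · exact (tracks_mul_ofSubtype u v k γ τ).2 hγ i hi
      · have : i = ⟨k, hk⟩ := Fin.ext hi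
        rw [this]; exact h
  rw [h1, Perm.mul_apply, Perm.ofSubtype_apply_of_mem τ (ne_of_val_lt u hk),
    ← Perm.eq_inv_iff_eq, Subtype.ext_iff]

variable [Fintype V] [DecidableEq V]

/-- The average of `F` over the configurations whose product tracks the first `k` paths, not
normalized. -/
noncomputable def trackedMass (u v : Fin s ↪ V) (c k : ℕ)
    (F : (Fin c → Perm V) → (Fin c → Perm V) → ℝ) : ℝ :=
  𝔼 α, 𝔼 β, F α β * (if Tracks u v k (altProd c α β) then 1 else 0)

lemma trackedMass_one (u v : Fin s ↪ V) (d k : ℕ) :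
    trackedMass u v (d + 1) k (fun _ _ => 1)
      = 𝔼 g : Fin (d + 1) → Perm V, 𝔼 _h : Fin (d + 1) → Perm V,
        (if Tracks u v k (g (Fin.last d)) then (1 : ℝ) else 0) := by
  have hp : altProd (d + 1) (1 : Fin (d + 1) → Perm V) 1 = 1 :=
    altProd_map (1 : Perm V →* Perm V) (d + 1) 1 1
  unfold trackedMass
  rw [expect_gauge 1 1]
  simp only [altProd_gauge, hp, mul_one, one_mul, ← Fin.succ_last, Fin.cons_succ]

lemma trackedMass_one_pos (u v : Fin s ↪ V) (d k : ℕ) :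
    0 < trackedMass u v (d + 1) k fun _ _ => 1 := by
  obtain ⟨σ, hσ⟩ := Perm.exists_extending_pair u v u.injective v.injective
  have h01 : ∀ τ : Perm V, (0 : ℝ) ≤ if Tracks u v k τ then 1 else 0 := fun τ => by
    split_ifs <;> norm_num
  rw [trackedMass_one]
  simp only [Fintype.expect_const]
  refine expect_pos' (fun g _ => h01 _) ⟨fun _ => σ, mem_univ _, ?_⟩
  have hT : Tracks u v k σ := fun i _ => hσ i
  simp [hT]

/-- Prescribing one more path: the change of the mass is bounded by the discrepancies of `F` along
one path off the tracked ones. -/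
lemma abs_trackedMass_succ_sub_le (u v : Fin s ↪ V) (d k : ℕ) (hk : k < s)
    (F : (Fin (d + 1) → Perm V) → (Fin (d + 1) → Perm V) → ℝ) (ε : ℝ)
    (hF : ∀ (g h : Fin (d + 1) → Perm V) (x y : Untracked u k),
      |𝔼 a : Fin (d + 1) → Perm (Untracked u k), 𝔼 b : Fin (d + 1) → Perm (Untracked u k),
        F (gaugeLeft g h fun i => Perm.ofSubtype (a i))
            (gaugeRight g h fun i => Perm.ofSubtype (b i))
          * ((Fintype.card (Untracked u k) : ℝ) * (if altProd (d + 1) a b x = y then 1 else 0) - 1)|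
      ≤ ε) :
    |Fintype.card (Untracked u k) * trackedMass u v (d + 1) (k + 1) F
        - trackedMass u v (d + 1) k F|
      ≤ ε * trackedMass u v (d + 1) k fun _ _ => 1 := by
  set n : ℝ := (Fintype.card (Untracked u k) : ℝ) with hn
  set Φ : (Fin (d + 1) → Perm V) → (Fin (d + 1) → Perm V) → ℝ := fun α β =>
    F α β * (n * (if Tracks u v (k + 1) (altProd (d + 1) α β) then 1 else 0)
      - (if Tracks u v k (altProd (d + 1) α β) then 1 else 0)) with hΦ
  have h1 : n * trackedMass u v (d + 1) (k + 1) F - trackedMass u v (d + 1) k F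
      = 𝔼 α, 𝔼 β, Φ α β := by
    unfold trackedMass
    rw [mul_expect, ← expect_sub_distrib]
    refine expect_congr rfl fun α _ => ?_
    rw [mul_expect, ← expect_sub_distrib]
    exact expect_congr rfl fun β _ => by simp only [hΦ]; ring
  -- The gauge identity holds for every base point, hence also on average over base points supported
  -- on the untracked points. The averages over frames are then moved outside.
  have h2 : 𝔼 α, 𝔼 β, Φ α β = 𝔼 g : Fin (d + 1) → Perm V, 𝔼 h : Fin (d + 1) → Perm V,
      𝔼 a : Fin (d + 1) → Perm (Untracked u k), 𝔼 b : Fin (d + 1) → Perm (Untracked u k),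
        Φ (gaugeLeft g h fun i => Perm.ofSubtype (a i))
          (gaugeRight g h fun i => Perm.ofSubtype (b i)) := by
    calc 𝔼 α, 𝔼 β, Φ α β
        = 𝔼 a : Fin (d + 1) → Perm (Untracked u k), 𝔼 b : Fin (d + 1) → Perm (Untracked u k),
          𝔼 g : Fin (d + 1) → Perm V, 𝔼 h : Fin (d + 1) → Perm V,
          Φ (gaugeLeft g h fun i => Perm.ofSubtype (a i))
            (gaugeRight g h fun i => Perm.ofSubtype (b i)) := by
          simp only [← expect_gauge _ _ Φ, Fintype.expect_const]
      _ = 𝔼 a : Fin (d + 1) → Perm (Untracked u k), 𝔼 g : Fin (d + 1) → Perm V,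
          𝔼 b : Fin (d + 1) → Perm (Untracked u k), 𝔼 h : Fin (d + 1) → Perm V,
          Φ (gaugeLeft g h fun i => Perm.ofSubtype (a i))
            (gaugeRight g h fun i => Perm.ofSubtype (b i)) :=
          expect_congr rfl fun a _ => expect_comm _ _ _
      _ = 𝔼 g : Fin (d + 1) → Perm V, 𝔼 a : Fin (d + 1) → Perm (Untracked u k),
          𝔼 h : Fin (d + 1) → Perm V, 𝔼 b : Fin (d + 1) → Perm (Untracked u k),
          Φ (gaugeLeft g h fun i => Perm.ofSubtype (a i))
            (gaugeRight g h fun i => Perm.ofSubtype (b i)) := by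
          rw [expect_comm]
          exact expect_congr rfl fun g _ => expect_congr rfl fun a _ => expect_comm _ _ _
      _ = _ := expect_congr rfl fun g _ => expect_comm _ _ _
  rw [h1, h2, trackedMass_one, mul_expect]
  refine (abs_expect_le _ _).trans (expect_le_expect fun g _ => ?_)
  rw [mul_expect]
  refine (abs_expect_le _ _).trans (expect_le_expect fun h _ => ?_)
  simp only [hΦ, altProd_gauge, altProd_map, ← Fin.succ_last, Fin.cons_succ, tracks_mul_ofSubtype]
  by_cases hγ : Tracks u v k (g (Fin.last d))
  · simp only [tracks_succ_mul_ofSubtype hγ hk, if_pos hγ, mul_one]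
    exact hF g h _ _
  -- If the frame already violates one of the first k conditions, both indicators vanish and nothing
  -- is to be shown.
  · have hγ' : ∀ τ : Perm (Untracked u k),
        ¬ Tracks u v (k + 1) (g (Fin.last d) * Perm.ofSubtype τ) := fun τ hτ =>
      hγ ((tracks_mul_ofSubtype u v k _ τ).1 fun i hi => hτ i (Nat.lt_succ_of_lt hi))
    simp [hγ, hγ']

lemma expect_expect_onePath_eq_zero {X : Type*} [Fintype X] [DecidableEq X] (d : ℕ) (x y : X) :
    𝔼 a : Fin (d + 1) → Perm X, 𝔼 b : Fin (d + 1) → Perm X,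
      ((Fintype.card X : ℝ) * (if altProd (d + 1) a b x = y then 1 else 0) - 1) = 0 := by
  have : Nonempty X := ⟨x⟩
  have hn : (Fintype.card X : ℝ) ≠ 0 := by exact_mod_cast Fintype.card_ne_zero
  refine expect_eq_zero fun a _ => ?_
  rw [expect_fin_succ]
  refine expect_eq_zero fun b _ => ?_
  simp only [altProd, Fin.snoc_last, Fin.snoc_castSucc, Perm.mul_apply]
  rw [expect_perm_apply fun z =>
    (Fintype.card X : ℝ) * (if a (Fin.last d) z = y then 1 else 0) - 1]
  rw [Fintype.expect_eq_sum_div_card, sum_sub_distrib, ← mul_sum]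
  simp [← Perm.eq_inv_iff_eq]

/-- The constant test has no discrepancy along one path, so each further value divides the mass
exactly by the number of untracked points. -/
lemma card_mul_trackedMass_succ_one (u v : Fin s ↪ V) (d k : ℕ) (hk : k < s) :
    Fintype.card (Untracked u k) * trackedMass u v (d + 1) (k + 1) (fun _ _ => 1)
      = trackedMass u v (d + 1) k fun _ _ => 1 := by
  have h := abs_trackedMass_succ_sub_le u v d k hk (fun _ _ => 1) 0 fun g h x y => by
    simp only [one_mul, expect_expect_onePath_eq_zero, abs_zero, le_refl]
  rw [zero_mul, abs_nonpos_iff, sub_eq_zero] at h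
  exact h

/-- A short message about `α` together with `β` hardly depends on where the tracked paths end. -/
theorem abs_trackedMass_div_sub_expect_le (u v : Fin s ↪ V) (hs : s < Fintype.card V) (C d : ℕ)
    {Msg : Type*} [Fintype Msg] [DecidableEq Msg] (hMsg : Fintype.card Msg ≤ 3 ^ C)
    (m : (Fin (d + 1) → Perm V) → Msg) (t : Msg → (Fin (d + 1) → Perm V) → ℝ)
    (ht : ∀ μ β, |t μ β| ≤ 1) :
    |trackedMass u v (d + 1) s (fun α β => t (m α) β) / trackedMass u v (d + 1) s (fun _ _ => 1)
        - 𝔼 α, 𝔼 β, t (m α) β|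
      ≤ s * (2 * √(Fintype.card V * (((C : ℝ) + 2) / (Fintype.card V - s)) ^ d)) := by
  set F : (Fin (d + 1) → Perm V) → (Fin (d + 1) → Perm V) → ℝ := fun α β => t (m α) β with hF
  set ε : ℝ := 2 * √(Fintype.card V * (((C : ℝ) + 2) / (Fintype.card V - s)) ^ d) with hε
  have hsV : (s : ℝ) < Fintype.card V := by exact_mod_cast hs
  suffices h : ∀ k ≤ s, |trackedMass u v (d + 1) k F / trackedMass u v (d + 1) k (fun _ _ => 1)
      - 𝔼 α, 𝔼 β, F α β| ≤ k * ε from h s le_rfl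
  intro k
  induction k with
  | zero => intro _; simp [trackedMass, Tracks]
  | succ k ih =>
    intro hk
    have hk' : k < s := hk
    have hkr : (k : ℝ) + 1 ≤ s := by exact_mod_cast hk
    have hcard := card_untracked u k hk'.le
    have hcardr : (Fintype.card (Untracked u k) : ℝ) = Fintype.card V - k := by
      rw [hcard, Nat.cast_sub (by omega)]
    have hpos := trackedMass_one_pos u v d k
    have hone := card_mul_trackedMass_succ_one u v d k hk'
    have hstep : |Fintype.card (Untracked u k) * trackedMass u v (d + 1) (k + 1) F
        - trackedMass u v (d + 1) k F| ≤ ε * trackedMass u v (d + 1) k fun _ _ => 1 := by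
      refine abs_trackedMass_succ_sub_le u v d k hk' F ε fun g h x y => ?_
      refine (abs_expect_onePath_le (X := Untracked u k) (by omega) C d hMsg
        (fun a => m (gaugeLeft g h fun i => Perm.ofSubtype (a i)))
        (fun μ b => t μ (gaugeRight g h fun i => Perm.ofSubtype (b i)))
        (fun μ b => ht μ _) x y).trans ?_
      rw [hcardr, hε]
      have h1 : (0 : ℝ) < Fintype.card V - s := by linarith
      -- The one-path bound is used on |V| - k points; k + 1 ≤ s makes it uniform in k.
      have h2 : (Fintype.card V : ℝ) - s ≤ Fintype.card V - k - 1 := by linarith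
      have h3 : (Fintype.card V : ℝ) - k ≤ Fintype.card V := by
        have : (0 : ℝ) ≤ k := Nat.cast_nonneg k
        linarith
      gcongr
      · exact pow_nonneg (div_nonneg (by positivity) (h1.le.trans h2)) d
      · exact div_nonneg (by positivity) (h1.le.trans h2)
    have hdiff : |trackedMass u v (d + 1) (k + 1) F / trackedMass u v (d + 1) (k + 1) (fun _ _ => 1)
        - trackedMass u v (d + 1) k F / trackedMass u v (d + 1) k (fun _ _ => 1)| ≤ ε := by
      have hn0 : (Fintype.card (Untracked u k) : ℝ) ≠ 0 := by
        rw [hcardr]; intro h; linarith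
      -- Multiplying the first quotient by the number of untracked points, above and below, gives
      -- both quotients the same denominator, by `hone`.
      rw [← mul_div_mul_left _ (trackedMass u v (d + 1) (k + 1) fun _ _ => 1) hn0, hone,
        ← sub_div, abs_div, abs_of_pos hpos, div_le_iff₀ hpos]
      exact hstep
    refine (abs_sub_le _ _ _).trans ((add_le_add hdiff (ih hk'.le)).trans (le_of_eq ?_))
    push_cast
    ring

end Paths

/-! ### Matchings as restrictions of permutations -/

section Restriction

variable {a b M : ℕ}

/-- The matching between the first `a` and the first `b` points that a permutation induces. -/
def restrictPerm (ha : a ≤ M) (hb : b ≤ M) (e : Perm (Fin M)) : Fin a ≃. Fin b where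
  toFun v := if h : (e (Fin.castLE ha v) : ℕ) < b then some ⟨_, h⟩ else none
  invFun w := if h : (e.symm (Fin.castLE hb w) : ℕ) < a then some ⟨_, h⟩ else none
  inv v w := by
    have key : e.symm (Fin.castLE hb w) = Fin.castLE ha v ↔ e (Fin.castLE ha v) = Fin.castLE hb w := by
      rw [Equiv.symm_apply_eq, eq_comm]
    simp only [Fin.ext_iff, Fin.val_castLE] at key
    constructor
    · intro h
      split_ifs at h with h1
      have h2 := key.1 (by simpa [Fin.ext_iff] using h)
      rw [dif_pos (by rw [h2]; exact w.2)]
      simpa [Fin.ext_iff] using h2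
    · intro h
      split_ifs at h with h1
      have h2 := key.2 (by simpa [Fin.ext_iff] using h)
      rw [dif_pos (by rw [h2]; exact v.2)]
      simpa [Fin.ext_iff] using h2

lemma restrictPerm_eq_some (ha : a ≤ M) (hb : b ≤ M) (e : Perm (Fin M)) (v : Fin a) (w : Fin b) :
    restrictPerm ha hb e v = some w ↔ e (Fin.castLE ha v) = Fin.castLE hb w := by
  change (if h : (e (Fin.castLE ha v) : ℕ) < b then some (⟨_, h⟩ : Fin b) else none) = some w ↔ _
  split_ifs with h
  · simp [Fin.ext_iff]
  · simp only [false_iff]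
    intro h'
    exact h (by rw [h']; exact w.2)

lemma exists_castLE_eq (hb : b = M) (y : Fin M) : ∃ w : Fin b, Fin.castLE hb.le w = y :=
  ⟨⟨y, by omega⟩, rfl⟩

lemma PEquiv.ext_some {α β : Type*} {f g : α ≃. β} (h : ∀ x y, f x = some y ↔ g x = some y) :
    f = g :=
  PEquiv.ext fun x => Option.ext fun y => h x y

lemma restrictPerm_symm (ha : a ≤ M) (hb : b ≤ M) (e : Perm (Fin M)) :
    (restrictPerm ha hb e).symm = restrictPerm hb ha e.symm := rfl

lemma card_filter_isSome_of_total (f : Fin a ≃. Fin b) (hf : ∀ v, ∃ w, f v = some w) :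
    (univ.filter fun v => (f v).isSome).card = a := by
  rw [filter_true_of_mem fun v _ => ?_]
  · simp
  · obtain ⟨w, hw⟩ := hf v
    simp [hw]

lemma card_filter_isSome_of_cototal (f : Fin a ≃. Fin b) (hf : ∀ w, ∃ v, f v = some w) :
    (univ.filter fun v => (f v).isSome).card = b := by
  choose g hg using hf
  have hinj : Function.Injective g := fun w w' h => by
    have := hg w
    rw [h, hg w'] at this
    exact (Option.some.inj this).symm
  have : (univ.filter fun v => (f v).isSome) = univ.image g := by
    ext v
    simp only [mem_filter, mem_univ, true_and, mem_image, Option.isSome_iff_exists]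
    constructor
    · rintro ⟨w, hw⟩
      exact ⟨w, f.inj (hg w) hw⟩
    · rintro ⟨w, rfl⟩
      exact ⟨w, hg w⟩
  rw [this, card_image_of_injective _ hinj, card_univ, Fintype.card_fin]

lemma total_of_card_filter_isSome (f : Fin a ≃. Fin b)
    (hf : (univ.filter fun v => (f v).isSome).card = a) (v : Fin a) : ∃ w, f v = some w := by
  have h := filter_card_eq (s := univ) (p := fun v => (f v).isSome) (by simpa using hf) v (mem_univ v)
  exact Option.isSome_iff_exists.1 h

lemma card_filter_isSome_symm (f : Fin a ≃. Fin b) :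
    (univ.filter fun v => (f v).isSome).card = (univ.filter fun w => (f.symm w).isSome).card := by
  refine card_bij (fun v hv => (f v).get (mem_filter.1 hv).2) ?_ ?_ ?_
  · intro v hv
    have h : f v = some ((f v).get (mem_filter.1 hv).2) := (Option.some_get _).symm
    simp only [mem_filter, mem_univ, true_and, Option.isSome_iff_exists]
    exact ⟨v, (PEquiv.eq_some_iff f).2 h⟩
  · intro v hv v' hv' h
    have h1 : f v = some ((f v).get (mem_filter.1 hv).2) := (Option.some_get _).symm
    have h2 : f v' = some ((f v').get (mem_filter.1 hv').2) := (Option.some_get _).symm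
    rw [h] at h1
    exact f.inj h1 h2
  · intro w hw
    obtain ⟨v, hv⟩ := Option.isSome_iff_exists.1 (mem_filter.1 hw).2
    have hv' : f v = some w := (PEquiv.eq_some_iff f).1 hv
    refine ⟨v, by simp [hv'], by simp [hv']⟩

lemma exists_restrictPerm_eq_of_total (ha : a ≤ M) (hb : b = M) (f : Fin a ≃. Fin b)
    (hf : ∀ v, ∃ w, f v = some w) : ∃ e, restrictPerm ha hb.le e = f := by
  choose g hg using hf
  have hinj : Function.Injective g := fun v v' h => by
    have := hg v
    rw [h] at this
    exact f.inj this (hg v')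
  obtain ⟨e, he⟩ := Perm.exists_extending_pair (Fin.castLE ha) (fun v => Fin.castLE hb.le (g v))
    (Fin.castLE_injective ha) ((Fin.castLE_injective hb.le).comp hinj)
  refine ⟨e, PEquiv.ext_some fun v w => ?_⟩
  rw [restrictPerm_eq_some, he, hg]
  simp [Fin.ext_iff]

/-- Every matching of full size is induced by a permutation, if one of its two sides is
everything. -/
lemma exists_restrictPerm_eq (ha : a ≤ M) (hb : b ≤ M) (hab : a = M ∨ b = M) (f : Fin a ≃. Fin b)
    (hf : (univ.filter fun v => (f v).isSome).card = min a b) :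
    ∃ e, restrictPerm ha hb e = f := by
  rcases hab with h | h
  · rw [min_eq_right (by omega), card_filter_isSome_symm] at hf
    obtain ⟨e, he⟩ := exists_restrictPerm_eq_of_total hb h f.symm (total_of_card_filter_isSome _ hf)
    refine ⟨e.symm, ?_⟩
    rw [← restrictPerm_symm hb ha, he, PEquiv.symm_symm]
  · rw [min_eq_left (by omega)] at hf
    exact exists_restrictPerm_eq_of_total ha h f (total_of_card_filter_isSome _ hf)

lemma card_filter_restrictPerm (ha : a ≤ M) (hb : b ≤ M) (hab : a = M ∨ b = M)
    (e : Perm (Fin M)) :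
    (univ.filter fun v => (restrictPerm ha hb e v).isSome).card = min a b := by
  rcases hab with h | h
  · rw [min_eq_right (by omega)]
    refine card_filter_isSome_of_cototal _ fun w => ?_
    obtain ⟨v, hv⟩ := exists_castLE_eq h (e.symm (Fin.castLE hb w))
    exact ⟨v, (restrictPerm_eq_some ..).2 (by rw [hv, Equiv.apply_symm_apply])⟩
  · rw [min_eq_left (by omega)]
    refine card_filter_isSome_of_total _ fun v => ?_
    obtain ⟨w, hw⟩ := exists_castLE_eq h (e (Fin.castLE ha v))
    exact ⟨w, (restrictPerm_eq_some ..).2 hw.symm⟩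

/-- The permutations that induce a given matching form a coset of a fixed group, on the side of the
full layer. -/
lemma exists_perm_restrictPerm_transport (ha : a ≤ M) (hb : b ≤ M) (hab : a = M ∨ b = M)
    (e e' : Perm (Fin M)) :
    ∃ φ : Perm (Fin M) → Perm (Fin M), Function.Injective φ ∧
      ∀ f, restrictPerm ha hb f = restrictPerm ha hb e →
        restrictPerm ha hb (φ f) = restrictPerm ha hb e' := by
  rcases hab with h | h
  · refine ⟨fun f => f * (e⁻¹ * e'), mul_left_injective _, fun f hf => PEquiv.ext_some fun v w => ?_⟩
    have hinv : f⁻¹ (Fin.castLE hb w) = e⁻¹ (Fin.castLE hb w) := by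
      obtain ⟨v', hv'⟩ := exists_castLE_eq h (e⁻¹ (Fin.castLE hb w))
      rw [Perm.inv_eq_iff_eq, ← hv', eq_comm, ← restrictPerm_eq_some ha hb, hf,
        restrictPerm_eq_some, hv', ← Perm.mul_apply, mul_inv_cancel, Perm.one_apply]
    rw [restrictPerm_eq_some, restrictPerm_eq_some, Perm.mul_apply, ← Perm.eq_inv_iff_eq, hinv,
      Perm.mul_apply, EmbeddingLike.apply_eq_iff_eq]
  · refine ⟨fun f => e' * e⁻¹ * f, mul_right_injective _, fun f hf => PEquiv.ext_some fun v w => ?_⟩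
    have hv : f (Fin.castLE ha v) = e (Fin.castLE ha v) := by
      obtain ⟨w', hw'⟩ := exists_castLE_eq h (e (Fin.castLE ha v))
      rw [← hw', ← restrictPerm_eq_some ha hb, hf, restrictPerm_eq_some, hw']
    rw [restrictPerm_eq_some, restrictPerm_eq_some, Perm.mul_apply, hv, Perm.mul_apply,
      ← Perm.mul_apply e⁻¹, inv_mul_cancel, Perm.one_apply]

end Restriction

/-! ### Layered graphs from sequences of permutations -/

/-- The inner layers of `T = (t_0, …, t_{2c})` have size `M`, and the outer ones at most `M`. -/
structure FullInside (T : List ℕ) (c M : ℕ) : Prop where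
  pos : 0 < c
  length_eq : T.length = 2 * c + 1
  le : ∀ i, layerSize T i ≤ M
  inner : ∀ i, 0 < i → i < 2 * c → layerSize T i = M

namespace FullInside

variable {T : List ℕ} {c M : ℕ}

lemma full_or_full (hT : FullInside T c M) (i : Fin (T.length - 1)) :
    layerSize T i = M ∨ layerSize T (i + 1) = M := by
  have hi := i.2
  have h1 := hT.length_eq
  have h2 := hT.pos
  by_cases h : (i : ℕ) = 0
  · exact Or.inr (hT.inner _ (by omega) (by omega))
  · exact Or.inl (hT.inner _ (by omega) (by omega))

/-- The layered graph with the matchings that the permutations `e_i` induce. -/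
def graph (hT : FullInside T c M) (e : Fin (T.length - 1) → Perm (Fin M)) : LayeredGraph T where
  edge i := restrictPerm (hT.le i) (hT.le (i + 1)) (e i)
  card_edge i := card_filter_restrictPerm _ _ (hT.full_or_full i) _

lemma graph_surjective (hT : FullInside T c M) : Function.Surjective hT.graph := by
  intro G
  choose e he using fun i : Fin (T.length - 1) =>
    exists_restrictPerm_eq (hT.le i) (hT.le (i + 1)) (hT.full_or_full i)
    (G.edge i) (G.card_edge i)
  exact ⟨e, LayeredGraph.ext (funext he)⟩

-- Coordinatewise transport between the cosets of permutations inducing the two graphs. Applied in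
-- both directions, it shows that all fibers have the same size.
open Classical in
lemma card_fiber_le (hT : FullInside T c M) (G G' : LayeredGraph T) :
    (univ.filter fun e => hT.graph e = G).card ≤ (univ.filter fun e => hT.graph e = G').card := by
  obtain ⟨e, rfl⟩ := hT.graph_surjective G
  obtain ⟨e', rfl⟩ := hT.graph_surjective G'
  choose φ hφ hφ' using fun i : Fin (T.length - 1) =>
    exists_perm_restrictPerm_transport (hT.le i) (hT.le (i + 1)) (hT.full_or_full i) (e i) (e' i)
  refine card_le_card_of_injOn (fun f i => φ i (f i)) ?_ ?_
  · intro f hf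
    simp only [coe_filter, mem_univ, true_and, Set.mem_ofPred_eq] at hf ⊢
    refine LayeredGraph.ext (funext fun i => hφ' i (f i) ?_)
    exact congrFun (congrArg LayeredGraph.edge hf) i
  · intro f _ f' _ h
    exact funext fun i => hφ i (congrFun h i)

end FullInside

/-- The product `e_{j-1} ⋯ e_i`, for `i ≤ j`. -/
def permWalk {G : Type*} [Group G] (e : ℕ → G) (i : ℕ) : ℕ → G
  | 0 => 1
  | j + 1 => if i = j + 1 then 1 else e j * permWalk e i j

lemma permWalk_self {G : Type*} [Group G] (e : ℕ → G) (i : ℕ) : permWalk e i i = 1 := by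
  cases i <;> simp [permWalk]

lemma altProd_eq_permWalk {G : Type*} [Group G] (e : ℕ → G) (c : ℕ) :
    altProd c (fun i => e (2 * i + 1)) (fun i => e (2 * i)) = permWalk e 0 (2 * c) := by
  induction c with
  | zero => rfl
  | succ c ih =>
    simp only [altProd, Fin.val_castSucc, Fin.val_last, ih]
    simp [mul_add, permWalk, mul_assoc]

namespace LayeredGraph

variable {T : List ℕ}

lemma path_self (G : LayeredGraph T) (i : ℕ) (v : Layer T i) : G.path i i v = some v := by
  cases i <;> simp [path]

lemma path_succ_eq_some (G : LayeredGraph T) {i j : ℕ} (hij : i ≤ j) (v : Layer T i)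
    (w : Layer T (j + 1)) :
    G.path i (j + 1) v = some w ↔ ∃ x, G.path i j v = some x ∧ G.step j x = some w := by
  rw [path, dif_neg (by omega)]
  exact PEquiv.trans_eq_some ..

end LayeredGraph

namespace FullInside

variable {T : List ℕ} {c M : ℕ}

/-- The sequence `e`, continued by `1`. -/
def extend (e : Fin (T.length - 1) → Perm (Fin M)) (i : ℕ) : Perm (Fin M) :=
  if h : i < T.length - 1 then e ⟨i, h⟩ else 1

lemma step_graph (hT : FullInside T c M) (e : Fin (T.length - 1) → Perm (Fin M)) {j : ℕ}
    (hj : j < T.length - 1) (x : Layer T j) (w : Layer T (j + 1)) :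
    (hT.graph e).step j x = some w
      ↔ extend e j (Fin.castLE (hT.le j) x) = Fin.castLE (hT.le (j + 1)) w := by
  rw [LayeredGraph.step, dif_pos hj, extend, dif_pos hj]
  exact restrictPerm_eq_some ..

/-- Restriction to layers commutes with composition here because every intermediate layer is full,
so no path is lost on the way. -/
lemma path_graph (hT : FullInside T c M) (e : Fin (T.length - 1) → Perm (Fin M)) {i j : ℕ}
    (hij : i < j) (hj : j ≤ T.length - 1) (v : Layer T i) (w : Layer T j) :
    (hT.graph e).path i j v = some w
      ↔ permWalk (extend e) i j (Fin.castLE (hT.le i) v) = Fin.castLE (hT.le j) w := by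
  induction j with
  | zero => omega
  | succ j ih =>
    have hlen := hT.length_eq
    rw [LayeredGraph.path_succ_eq_some _ (by omega), permWalk, if_neg (by omega), Perm.mul_apply]
    simp only [hT.step_graph e (show j < T.length - 1 by omega)]
    rcases Nat.lt_succ_iff_lt_or_eq.1 hij with h | h
    · simp only [ih h (by omega)]
      constructor
      · rintro ⟨x, hx, hx'⟩
        rw [hx, hx']
      · intro h'
        obtain ⟨x, hx⟩ := exists_castLE_eq (hT.inner j (by omega) (by omega))
          (permWalk (extend e) i j (Fin.castLE (hT.le i) v))
        exact ⟨x, hx.symm, by rw [hx, h']⟩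
    · subst h
      simp [LayeredGraph.path_self, permWalk_self]

lemma inf'_layerSize (hT : FullInside T c M) {i j : ℕ} (hij : i < j) (hj : j < T.length) :
    (Finset.Icc i j).inf' (Finset.nonempty_Icc.2 hij.le) (layerSize T)
      = min (layerSize T i) (layerSize T j) := by
  have hlen := hT.length_eq
  refine le_antisymm ?_ ?_
  · exact le_min (Finset.inf'_le _ (by simp [hij.le])) (Finset.inf'_le _ (by simp [hij.le]))
  · refine Finset.le_inf' _ _ fun k hk => ?_
    rw [Finset.mem_Icc] at hk
    rcases hk.1.eq_or_lt with rfl | h1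
    · exact min_le_left _ _
    rcases hk.2.eq_or_lt with rfl | h2
    · exact min_le_right _ _
    rw [hT.inner k (by omega) (by omega)]
    exact (min_le_left _ _).trans (hT.le i)

/-- The graph is nice if the paths between the two outer layers are as many as possible. -/
lemma nice_graph (hT : FullInside T c M) (e : Fin (T.length - 1) → Perm (Fin M))
    (h : (Finset.univ.filter fun v => ((hT.graph e).path 0 (T.length - 1) v).isSome).card
      = min (layerSize T 0) (layerSize T (T.length - 1))) : (hT.graph e).Nice := by
  intro i j hij hj
  have hlen := hT.length_eq
  rw [hT.inf'_layerSize hij hj]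
  by_cases h1 : i = 0 ∧ j = T.length - 1
  · obtain ⟨rfl, rfl⟩ := h1
    exact h
  -- For every other pair i < j one of the two layers is full, so the induced matching automatically
  -- has full size.
  · have hpath : (hT.graph e).path i j
        = restrictPerm (hT.le i) (hT.le j) (permWalk (extend e) i j) :=
      PEquiv.ext_some fun v w => by
        rw [hT.path_graph e hij (by omega), restrictPerm_eq_some]
    rw [hpath]
    refine card_filter_restrictPerm _ _ ?_ _
    by_cases h2 : i = 0
    · exact Or.inr (hT.inner j (by omega) (by omega))
    · exact Or.inl (hT.inner i (by omega) (by omega))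

lemma joins_graph (hT : FullInside T c M) (e : Fin (T.length - 1) → Perm (Fin M)) (a b : ℕ) :
    (hT.graph e).Joins a b ↔ ∃ (u : Layer T 0) (w : Layer T (T.length - 1)),
      (u : ℕ) = a ∧ (w : ℕ) = b ∧ (permWalk (extend e) 0 (T.length - 1) (Fin.castLE (hT.le _) u)
        = Fin.castLE (hT.le _) w) := by
  have hlen := hT.length_eq
  have hpos := hT.pos
  simp only [LayeredGraph.Joins, hT.path_graph e (show 0 < T.length - 1 by omega) le_rfl]

end FullInside

/-- Sequences of length `2c` are pairs of sequences of length `c`: first the entries with odd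
index, then those with even index. -/
def interleave {G : Type*} {c L : ℕ} (hL : L = 2 * c) :
    (Fin c → G) × (Fin c → G) ≃ (Fin L → G) where
  toFun p j := if (j : ℕ) % 2 = 0 then p.2 ⟨j / 2, by omega⟩ else p.1 ⟨j / 2, by omega⟩
  invFun e := (fun i => e ⟨2 * i + 1, by omega⟩, fun i => e ⟨2 * i, by omega⟩)
  left_inv p := by
    refine Prod.ext (funext fun i => ?_) (funext fun i => ?_)
    · simp only [show (2 * (i : ℕ) + 1) % 2 ≠ 0 by omega, if_false]
      exact congrArg p.1 (Fin.ext (by change (2 * (i : ℕ) + 1) / 2 = i; omega))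
    · simp
  right_inv e := by
    funext j
    dsimp only
    split_ifs with h
    · exact congrArg e (Fin.ext (by change 2 * ((j : ℕ) / 2) = j; omega))
    · exact congrArg e (Fin.ext (by change 2 * ((j : ℕ) / 2) + 1 = j; omega))

lemma interleave_apply_even {G : Type*} {c L : ℕ} (hL : L = 2 * c) (α α' β : Fin c → G)
    {j : Fin L} (hj : Even (j : ℕ)) : interleave hL (α, β) j = interleave hL (α', β) j := by
  simp [interleave, Nat.even_iff.1 hj]

lemma interleave_apply_odd {G : Type*} {c L : ℕ} (hL : L = 2 * c) (α β β' : Fin c → G)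
    {j : Fin L} (hj : Odd (j : ℕ)) : interleave hL (α, β) j = interleave hL (α, β') j := by
  simp [interleave, Nat.odd_iff.1 hj]

namespace FullInside

variable {T : List ℕ} {c M : ℕ}

lemma length_sub_one (hT : FullInside T c M) : T.length - 1 = 2 * c := by
  rw [hT.length_eq, Nat.add_sub_cancel]

/-- The graph with Alice's matchings from `α` and Bob's matchings from `β`. -/
def pairGraph (hT : FullInside T c M) (α β : Fin c → Perm (Fin M)) : LayeredGraph T :=
  hT.graph (interleave hT.length_sub_one (α, β))

lemma aliceInput_pairGraph (hT : FullInside T c M) (α β β' : Fin c → Perm (Fin M)) :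
    (hT.pairGraph α β).aliceInput = (hT.pairGraph α β').aliceInput := by
  funext j
  simp only [LayeredGraph.aliceInput, pairGraph, graph]
  rw [interleave_apply_odd hT.length_sub_one α β β' j.2]

lemma bobInput_pairGraph (hT : FullInside T c M) (α α' β : Fin c → Perm (Fin M)) :
    (hT.pairGraph α β).bobInput = (hT.pairGraph α' β).bobInput := by
  funext j
  simp only [LayeredGraph.bobInput, pairGraph, graph]
  rw [interleave_apply_even hT.length_sub_one α α' β j.2]

lemma permWalk_interleave (hT : FullInside T c M) (α β : Fin c → Perm (Fin M)) :
    permWalk (extend (T := T) (interleave hT.length_sub_one (α, β))) 0 (T.length - 1)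
      = altProd c α β := by
  have hlen := hT.length_sub_one
  set e := interleave hT.length_sub_one (α, β) with he
  have hp : (interleave hT.length_sub_one).symm e = (α, β) := by rw [he, Equiv.symm_apply_apply]
  have hα : (fun i : Fin c => extend (T := T) e (2 * i + 1)) = α := by
    refine Eq.trans ?_ (congrArg Prod.fst hp)
    funext i
    rw [extend, dif_pos (by omega)]
    rfl
  have hβ : (fun i : Fin c => extend (T := T) e (2 * i)) = β := by
    refine Eq.trans ?_ (congrArg Prod.snd hp)
    funext i
    rw [extend, dif_pos (by omega)]
    rfl
  rw [hT.length_sub_one, ← altProd_eq_permWalk, hα, hβ]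

end FullInside

/-! ### Uniform distributions -/

instance (T : List ℕ) : Finite (LayeredGraph T) := by
  have : ∀ i, Finite (Layer T i ≃. Layer T (i + 1)) := fun i =>
    Finite.of_injective (fun f : Layer T i ≃. Layer T (i + 1) => (f : Layer T i → Option _))
      DFunLike.coe_injective
  exact Finite.of_injective (fun G : LayeredGraph T => G.edge) fun G G' h => LayeredGraph.ext h

instance (T : List ℕ) : DiscreteMeasurableSpace (LayeredGraph T) := ⟨fun _ => trivial⟩

lemma uniformOn_real_apply {Ω : Type*} [Finite Ω] [MeasurableSpace Ω] [DiscreteMeasurableSpace Ω]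
    (S A : Set Ω) : (uniformOn S).real A = (S ∩ A).ncard / S.ncard := by
  rw [Measure.real, uniformOn, cond_apply (MeasurableSet.of_discrete), Measure.count_apply
    MeasurableSet.of_discrete, Measure.count_apply MeasurableSet.of_discrete, ENNReal.toReal_mul,
    ENNReal.toReal_inv, Set.ncard, Set.ncard]
  have h : ∀ B : Set Ω, ((B.encard : ENNReal)).toReal = (B.encard.toNat : ℝ) := fun B => by
    rw [← (Set.toFinite B).cast_ncard_eq, ENat.toENNReal_coe, ENNReal.toReal_natCast,
      ENat.toNat_natCast]
  rw [h, h, div_eq_mul_inv, mul_comm]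

lemma cond_niceDist_real_apply (T : List ℕ) (R A : Set (LayeredGraph T)) :
    (cond (niceDist T) R).real A = (({G | G.Nice} ∩ R) ∩ A).ncard / ({G | G.Nice} ∩ R).ncard := by
  rw [← uniformOn_real_apply, niceDist, uniformOn, uniformOn,
    cond_cond_eq_cond_inter MeasurableSet.of_discrete MeasurableSet.of_discrete]

namespace FullInside

variable {T : List ℕ} {c M : ℕ}

open Classical in
/-- All the graphs arise from equally many pairs of sequences of permutations. -/
lemma exists_card_filter_pairGraph (hT : FullInside T c M) : ∃ f : ℕ, 0 < f ∧
    ∀ A : Set (LayeredGraph T), (univ.filter fun p : (Fin c → Perm (Fin M)) × (Fin c → Perm (Fin M)) =>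
      hT.pairGraph p.1 p.2 ∈ A).card = f * A.ncard := by
  set G₀ := hT.graph 1
  refine ⟨(univ.filter fun e => hT.graph e = G₀).card, card_pos.2 ⟨1, by simp [G₀]⟩, fun A => ?_⟩
  have hfin := Set.toFinite A
  have h1 : (univ.filter fun p : (Fin c → Perm (Fin M)) × (Fin c → Perm (Fin M)) =>
      hT.pairGraph p.1 p.2 ∈ A).card = (univ.filter fun e => hT.graph e ∈ A).card := by
    refine card_equiv (interleave hT.length_sub_one) fun p => ?_
    simp [pairGraph]
  rw [h1, Set.ncard_eq_toFinset_card A hfin, mul_comm,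
    card_eq_sum_card_fiberwise (f := hT.graph) (t := hfin.toFinset) (by intro e he; simpa using he)]
  refine sum_const_nat fun G hG => ?_
  rw [filter_filter]
  refine Eq.trans (congrArg card (filter_congr fun e _ => ?_))
    (le_antisymm (hT.card_fiber_le G G₀) (hT.card_fiber_le G₀ G))
  constructor
  · exact fun h => h.2
  · rintro rfl
    exact ⟨by simpa using hG, rfl⟩

open Classical in
/-- Conditioned distributions on graphs, in terms of pairs of sequences of permutations. -/
lemma cond_niceDist_real_eq (hT : FullInside T c M) {s : ℕ} (u v : Fin s ↪ Fin M)
    (R : Set (LayeredGraph T))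
    (hR : ∀ α β, ((hT.pairGraph α β).Nice ∧ hT.pairGraph α β ∈ R) ↔ Tracks u v s (altProd c α β))
    (A : Set (LayeredGraph T)) :
    (cond (niceDist T) R).real A
      = trackedMass u v c s (fun α β => if hT.pairGraph α β ∈ A then 1 else 0)
        / trackedMass u v c s (fun _ _ => 1) := by
  obtain ⟨f, hf, hcard⟩ := hT.exists_card_filter_pairGraph
  set S : Set (LayeredGraph T) := {G | G.Nice} ∩ R with hS
  have hN : ∀ B : Set (LayeredGraph T),
      trackedMass u v c s (fun α β => if hT.pairGraph α β ∈ B then 1 else 0)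
        = (f * (S ∩ B).ncard : ℕ) / Fintype.card ((Fin c → Perm (Fin M)) × (Fin c → Perm (Fin M))) := by
    intro B
    rw [trackedMass, ← expect_product' univ univ fun α β =>
      (if hT.pairGraph α β ∈ B then (1 : ℝ) else 0)
        * if Tracks u v s (altProd c α β) then 1 else 0, univ_product_univ,
      Fintype.expect_eq_sum_div_card, ← hcard, ← sum_boole]
    congr 1
    refine sum_congr rfl fun p _ => ?_
    rw [ite_zero_mul_ite_zero, mul_one]
    have hiff : (hT.pairGraph p.1 p.2 ∈ B ∧ Tracks u v s (altProd c p.1 p.2))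
        ↔ hT.pairGraph p.1 p.2 ∈ S ∩ B := by
      rw [← hR, and_comm]
      rfl
    by_cases h : hT.pairGraph p.1 p.2 ∈ S ∩ B
    · rw [if_pos h, if_pos (hiff.2 h)]
    · rw [if_neg h, if_neg (mt hiff.1 h)]
  have h1 := hN Set.univ
  simp only [Set.mem_univ, if_true, Set.inter_univ] at h1
  rw [cond_niceDist_real_apply, hN, h1, div_div_div_cancel_right₀]
  · push_cast
    rw [mul_div_mul_left]
    exact_mod_cast hf.ne'
  · exact_mod_cast Fintype.card_ne_zero

end FullInside

/-! ### The two shapes of almost nested block graphs -/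

lemma fullInside_cons_replicate {a b c M : ℕ} (hc : 0 < c) (ha : a ≤ M) (hb : b ≤ M) :
    FullInside (a :: (List.replicate (2 * c - 1) M ++ [b])) c M
      ∧ layerSize (a :: (List.replicate (2 * c - 1) M ++ [b])) 0 = a
      ∧ layerSize (a :: (List.replicate (2 * c - 1) M ++ [b]))
          ((a :: (List.replicate (2 * c - 1) M ++ [b])).length - 1) = b := by
  have hval : ∀ i, layerSize (a :: (List.replicate (2 * c - 1) M ++ [b])) i
      = if i = 0 then a else if i < 2 * c then M else if i = 2 * c then b else 0 := by
    intro i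
    rcases i with _ | i
    · simp [layerSize]
    · simp only [layerSize, List.getD_eq_getElem?_getD, List.getElem?_cons_succ]
      rcases lt_trichotomy (i + 1) (2 * c) with h | h | h
      · rw [List.getElem?_append_left (by simp; omega)]
        simp [h, show i < 2 * c - 1 by omega]
      · rw [List.getElem?_append_right (by simp; omega)]
        simp [h, hc.ne', show i - (2 * c - 1) = 0 by omega]
      · rw [List.getElem?_append_right (by simp; omega)]
        have : i - (2 * c - 1) = (i - (2 * c - 1) - 1) + 1 := by omega
        rw [List.length_replicate, this]
        simp [show ¬ (i + 1 < 2 * c) by omega, show i + 1 ≠ 2 * c by omega]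
  have hlen : (a :: (List.replicate (2 * c - 1) M ++ [b])).length = 2 * c + 1 := by
    simp; omega
  refine ⟨⟨hc, hlen, fun i => ?_, fun i h0 h1 => ?_⟩, ?_, ?_⟩
  · rw [hval]; split_ifs <;> omega
  · rw [hval]; split_ifs <;> omega
  · rw [hval]; simp
  · rw [hval, hlen]; split_ifs <;> omega

lemma almostNest_left_eq (s c s₁ s₂ : ℕ) : almostNest .left s c [s₁, s₂]
    = s :: (List.replicate (2 * c - 1) s₂ ++ [s₁]) := by
  simp [almostNest, nest, plug]

lemma almostNest_right_eq (s c s₁ s₂ : ℕ) : almostNest .right s c [s₁, s₂]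
    = s₁ :: (List.replicate (2 * c - 1) s₂ ++ [s]) := by
  simp [almostNest, nest, plug]

namespace FullInside

variable {T : List ℕ} {c M s s₁ : ℕ}

/-- The smaller outer layer has s vertices, so prescribing the images of all of them determines the
final matching and also forces the missing part of niceness. -/
lemma nice_and_final_left_iff (hT : FullInside T c M) (h0 : layerSize T 0 = s)
    (hl : layerSize T (T.length - 1) = s₁) (hs : s ≤ s₁) (hM : s₁ ≤ M) (Z : Fin s ↪ Fin s₁)
    (α β : Fin c → Perm (Fin M)) :
    ((hT.pairGraph α β).Nice ∧ FinalMatchingEq .left Z (hT.pairGraph α β))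
      ↔ Tracks (Fin.castLEEmb (hs.trans hM)) (Z.trans (Fin.castLEEmb hM)) s (altProd c α β) := by
  have hpos := hT.pos
  have hlen := hT.length_sub_one
  rw [← hT.permWalk_interleave]
  unfold pairGraph
  set e := interleave hT.length_sub_one (α, β)
  set σ := permWalk (extend (T := T) e) 0 (T.length - 1) with hσ
  simp only [FinalMatchingEq, hT.joins_graph, Tracks, ← hσ]
  constructor
  · rintro ⟨-, h⟩ x -
    obtain ⟨u, w, hu, hw, huw⟩ := (h x (Z x)).2 ⟨x, rfl, rfl⟩
    have e1 : Fin.castLE (hT.le 0) u = Fin.castLEEmb (hs.trans hM) x := Fin.ext hu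
    have e2 : Fin.castLE (hT.le (T.length - 1)) w = (Z.trans (Fin.castLEEmb hM)) x := Fin.ext hw
    rw [← e1, ← e2, huw]
  · intro h
    have hpath : ∀ u : Layer T 0, σ (Fin.castLE (hT.le 0) u)
        = Fin.castLE hM (Z ⟨u, h0 ▸ u.2⟩) := fun u => h ⟨u, h0 ▸ u.2⟩ (h0 ▸ u.2)
    refine ⟨hT.nice_graph e ?_, fun a b => ⟨?_, ?_⟩⟩
    · rw [min_eq_left (by omega)]
      refine card_filter_isSome_of_total _ fun u => ⟨⟨Z ⟨u, h0 ▸ u.2⟩, by rw [hl]; exact Fin.isLt _⟩, ?_⟩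
      rw [hT.path_graph e (by omega) le_rfl]
      exact (hpath u).trans (Fin.ext rfl)
    · rintro ⟨u, w, rfl, rfl, huw⟩
      refine ⟨⟨u, h0 ▸ u.2⟩, rfl, ?_⟩
      rw [hpath u] at huw
      exact congrArg Fin.val huw
    · rintro ⟨x, rfl, rfl⟩
      refine ⟨⟨x, by rw [h0]; exact x.2⟩, ⟨Z x, by rw [hl]; exact (Z x).2⟩, rfl, rfl, ?_⟩
      rw [hpath]
      exact Fin.ext rfl

lemma nice_and_final_right_iff (hT : FullInside T c M) (h0 : layerSize T 0 = s₁)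
    (hl : layerSize T (T.length - 1) = s) (hs : s ≤ s₁) (hM : s₁ ≤ M) (Z : Fin s ↪ Fin s₁)
    (α β : Fin c → Perm (Fin M)) :
    ((hT.pairGraph α β).Nice ∧ FinalMatchingEq .right Z (hT.pairGraph α β))
      ↔ Tracks (Z.trans (Fin.castLEEmb hM)) (Fin.castLEEmb (hs.trans hM)) s (altProd c α β) := by
  have hpos := hT.pos
  have hlen := hT.length_sub_one
  rw [← hT.permWalk_interleave]
  unfold pairGraph
  set e := interleave hT.length_sub_one (α, β)
  set σ := permWalk (extend (T := T) e) 0 (T.length - 1) with hσ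
  simp only [FinalMatchingEq, hT.joins_graph, Tracks, ← hσ]
  constructor
  · rintro ⟨-, h⟩ x -
    obtain ⟨u, w, hu, hw, huw⟩ := (h (Z x) x).2 ⟨x, rfl, rfl⟩
    have e1 : Fin.castLE (hT.le 0) u = (Z.trans (Fin.castLEEmb hM)) x := Fin.ext hu
    have e2 : Fin.castLE (hT.le (T.length - 1)) w = Fin.castLEEmb (hs.trans hM) x := Fin.ext hw
    rw [← e1, ← e2, huw]
  · intro h
    have hpath : ∀ w : Layer T (T.length - 1), σ (Fin.castLE hM (Z ⟨w, hl ▸ w.2⟩))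
        = Fin.castLE (hT.le (T.length - 1)) w := fun w => h ⟨w, hl ▸ w.2⟩ (hl ▸ w.2)
    refine ⟨hT.nice_graph e ?_, fun a b => ⟨?_, ?_⟩⟩
    · rw [min_eq_right (by omega)]
      refine card_filter_isSome_of_cototal _ fun w => ⟨⟨Z ⟨w, hl ▸ w.2⟩, by rw [h0]; exact Fin.isLt _⟩, ?_⟩
      rw [hT.path_graph e (by omega) le_rfl]
      exact hpath w
    · rintro ⟨u, w, rfl, rfl, huw⟩
      refine ⟨⟨w, hl ▸ w.2⟩, rfl, ?_⟩
      rw [← hpath w] at huw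
      exact (congrArg Fin.val (σ.injective huw)).symm
    · rintro ⟨x, rfl, rfl⟩
      refine ⟨⟨Z x, by rw [h0]; exact (Z x).2⟩, ⟨x, by rw [hl]; exact x.2⟩, rfl, rfl, ?_⟩
      exact hpath ⟨x, by rw [hl]; exact x.2⟩

end FullInside

/-- The conditions on an almost nested block graph, in terms of permutations of `[s₂]`. -/
theorem almostNest_nice_and_final_iff (side : Side) {s c s₁ s₂ : ℕ} (hc : 0 < c) (hs : s ≤ s₁)
    (hM : s₁ ≤ s₂) :
    ∃ hT : FullInside (almostNest side s c [s₁, s₂]) c s₂, ∀ Z : Fin s ↪ Fin s₁,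
      ∃ u v : Fin s ↪ Fin s₂, ∀ α β,
        ((hT.pairGraph α β).Nice ∧ FinalMatchingEq side Z (hT.pairGraph α β))
          ↔ Tracks u v s (altProd c α β) := by
  cases side with
  | left =>
    obtain ⟨hT, h0, hl⟩ := fullInside_cons_replicate hc (hs.trans hM) hM
    rw [← almostNest_left_eq s c s₁ s₂] at hT h0 hl
    exact ⟨hT, fun Z => ⟨_, _, hT.nice_and_final_left_iff h0 hl hs hM Z⟩⟩
  | right =>
    obtain ⟨hT, h0, hl⟩ := fullInside_cons_replicate hc hM (hs.trans hM)
    rw [← almostNest_right_eq s c s₁ s₂] at hT h0 hl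
    exact ⟨hT, fun Z => ⟨_, _, hT.nice_and_final_right_iff h0 hl hs hM Z⟩⟩

/-! ### Protocols with one message -/

lemma DetProtocol.output_one {T : List ℕ} {O : Type*} (π : DetProtocol 1 T O)
    (G : LayeredGraph T) :
    π.output G = π.bobOut G.bobInput [π.aliceMsg G.aliceInput []] := by
  simp [DetProtocol.output, DetProtocol.transcript]

lemma DetProtocol.bits_one {T : List ℕ} {O : Type*} (π : DetProtocol 1 T O)
    (G : LayeredGraph T) : π.bits G = (π.aliceMsg G.aliceInput []).length := by
  simp [DetProtocol.bits, DetProtocol.transcript]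

/-- A code for bit strings of length at most `C`. -/
def encodeBits (C : ℕ) (l : List Bool) : Fin C → Option Bool := fun i => l[(i : ℕ)]?

lemma encodeBits_injOn (C : ℕ) : Set.InjOn (encodeBits C) {l | l.length ≤ C} := by
  intro l hl l' hl' h
  refine List.ext_getElem? fun i => ?_
  by_cases hi : i < C
  · exact congrFun h ⟨i, hi⟩
  · rw [Set.mem_ofPred_eq] at hl hl'
    rw [List.getElem?_eq_none (by omega), List.getElem?_eq_none (by omega)]

open Classical in
/-- A protocol with one short message hardly distinguishes two final matchings. -/
theorem abs_cond_real_output_sub_le {T : List ℕ} {c M s C : ℕ} (hT : FullInside T c M)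
    (hs : s < M) {O : Type*} (π : DetProtocol 1 T O) (hπ : ∀ G : LayeredGraph T, G.Nice → π.bits G ≤ C)
    (A : Set O) (R R' : Set (LayeredGraph T)) (u v u' v' : Fin s ↪ Fin M)
    (hR : ∀ α β, ((hT.pairGraph α β).Nice ∧ hT.pairGraph α β ∈ R) ↔ Tracks u v s (altProd c α β))
    (hR' : ∀ α β, ((hT.pairGraph α β).Nice ∧ hT.pairGraph α β ∈ R')
      ↔ Tracks u' v' s (altProd c α β)) :
    |(cond (niceDist T) R).real {G | π.output G ∈ A}
        - (cond (niceDist T) R').real {G | π.output G ∈ A}|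
      ≤ 2 * (s * (2 * √(M * (((C : ℝ) + 2) / (M - s)) ^ (c - 1)))) := by
  set m : (Fin c → Perm (Fin M)) → (Fin C → Option Bool) := fun α =>
    encodeBits C (π.aliceMsg (hT.pairGraph α 1).aliceInput []) with hm
  -- Bob decodes the message. Decoding may fail for messages longer than C, but these do not occur
  -- on nice graphs, and so not on tracked configurations.
  set t : (Fin C → Option Bool) → (Fin c → Perm (Fin M)) → ℝ := fun μ β =>
    if π.bobOut (hT.pairGraph 1 β).bobInput
      [Function.invFunOn (encodeBits C) {l | l.length ≤ C} μ] ∈ A then 1 else 0 with ht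
  have ht1 : ∀ μ β, |t μ β| ≤ 1 := fun μ β => by simp only [ht]; split_ifs <;> simp
  have hcard : Fintype.card (Fin C → Option Bool) ≤ 3 ^ C := by simp
  -- The reference mean of `t` does not depend on R, u or v, so it serves for both final matchings.
  have main : ∀ (R : Set (LayeredGraph T)) (u v : Fin s ↪ Fin M),
      (∀ α β, ((hT.pairGraph α β).Nice ∧ hT.pairGraph α β ∈ R) ↔ Tracks u v s (altProd c α β)) →
      |(cond (niceDist T) R).real {G | π.output G ∈ A} - 𝔼 α, 𝔼 β, t (m α) β|
        ≤ s * (2 * √(M * (((C : ℝ) + 2) / (M - s)) ^ (c - 1))) := by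
    intro R u v hR
    have hmass : trackedMass u v c s
        (fun α β => if hT.pairGraph α β ∈ {G | π.output G ∈ A} then 1 else 0)
        = trackedMass u v c s fun α β => t (m α) β := by
      unfold trackedMass
      refine expect_congr rfl fun α _ => expect_congr rfl fun β _ => ?_
      by_cases hα : Tracks u v s (altProd c α β)
      · rw [if_pos hα]
        congr 1
        have hlen := hπ _ ((hR α β).2 hα).1
        rw [DetProtocol.bits_one] at hlen
        have hdec := (encodeBits_injOn C).leftInvOn_invFunOn hlen
        rw [hT.aliceInput_pairGraph α β 1] at hdec
        simp only [ht, hm, hdec, Set.mem_ofPred_eq, DetProtocol.output_one,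
          hT.aliceInput_pairGraph α β 1, hT.bobInput_pairGraph α 1 β]
      · rw [if_neg hα, mul_zero, mul_zero]
    rw [hT.cond_niceDist_real_eq u v R hR, hmass]
    obtain ⟨d, rfl⟩ : ∃ d, c = d + 1 := ⟨c - 1, by have := hT.pos; omega⟩
    have := abs_trackedMass_div_sub_expect_le u v (by simpa using hs) C d hcard m t ht1
    simpa using this
  have h1 := main R u v hR
  have h2 := main R' u' v' hR'
  rw [abs_sub_comm] at h2
  refine (abs_sub_le _ _ _).trans ((add_le_add h1 h2).trans (le_of_eq (by ring)))

/-! ### Randomized protocols -/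

lemma RandProtocol.bits_le {T : List ℕ} {r C : ℕ} {Ω O : Type*} [MeasurableSpace Ω]
    [MeasurableSpace O] {P : RandProtocol r T Ω O} (hP : P.cost ≤ C) (ω : Ω) (G : LayeredGraph T)
    (hG : G.Nice) : (P.det ω).bits G ≤ C := by
  have h : (((P.det ω).bits G : ℕ) : ℕ∞) ≤ P.cost :=
    le_iSup_of_le ω (le_iSup_of_le G (le_iSup_of_le hG le_rfl))
  exact_mod_cast h.trans hP

/-- There are countably many graphs and countably many messages, so splitting by both reduces joint
measurability to that of single rules. -/
lemma RandProtocol.measurable_output_one {T : List ℕ} {Ω O : Type*} [MeasurableSpace Ω]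
    [MeasurableSpace O] (P : RandProtocol 1 T Ω O) :
    Measurable fun p : Ω × LayeredGraph T => (P.det p.1).output p.2 := by
  refine measurable_from_prod_countable_left fun G => ?_
  simp only [DetProtocol.output_one]
  intro A hA
  have : (fun ω => (P.det ω).bobOut G.bobInput [(P.det ω).aliceMsg G.aliceInput []]) ⁻¹' A
      = ⋃ l : List Bool, {ω | (P.det ω).aliceMsg G.aliceInput [] = l}
        ∩ (fun ω => (P.det ω).bobOut G.bobInput [l]) ⁻¹' A := by
    ext ω
    simp
  rw [this]
  exact MeasurableSet.iUnion fun l =>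
    (P.measurableSet_aliceMsg _ _ _).inter (P.measurable_bobOut _ _ hA)

lemma RandProtocol.outputLaw_real_apply {T : List ℕ} {Ω O : Type*} [MeasurableSpace Ω]
    [MeasurableSpace O] (P : RandProtocol 1 T Ω O) (μ : Measure Ω) [IsProbabilityMeasure μ]
    (D : Measure (LayeredGraph T)) [IsFiniteMeasure D] {A : Set O} (hA : MeasurableSet A) :
    Integrable (fun ω => D.real {G | (P.det ω).output G ∈ A}) μ ∧
      (P.outputLaw μ D).real A = ∫ ω, D.real {G | (P.det ω).output G ∈ A} ∂μ := by
  have hmeas := P.measurable_output_one hA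
  have hD := measurable_measure_prodMk_left (ν := D) hmeas
  constructor
  · refine Integrable.of_bound (C := D.real Set.univ) hD.ennreal_toReal.aestronglyMeasurable
      (Filter.Eventually.of_forall fun ω => ?_)
    rw [Real.norm_of_nonneg measureReal_nonneg]
    exact measureReal_mono (Set.subset_univ _)
  · rw [outputLaw, measureReal_def, Measure.map_apply P.measurable_output_one hA,
      Measure.prod_apply hmeas, ← integral_toReal hD.aemeasurable
        (Filter.Eventually.of_forall fun ω => measure_lt_top _ _)]
    rfl

/-- If the random deterministic protocols are all bad at distinguishing, so is the randomized
one. -/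
lemma RandProtocol.tvDist_outputLaw_le {T : List ℕ} {Ω O : Type*} [MeasurableSpace Ω]
    [MeasurableSpace O] (P : RandProtocol 1 T Ω O) (μ : Measure Ω) [IsProbabilityMeasure μ]
    (D D' : Measure (LayeredGraph T)) [IsFiniteMeasure D] [IsFiniteMeasure D'] {ε : ℝ}
    (h : ∀ ω (A : Set O), |D.real {G | (P.det ω).output G ∈ A}
      - D'.real {G | (P.det ω).output G ∈ A}| ≤ ε) :
    tvDist (P.outputLaw μ D) (P.outputLaw μ D') ≤ ε := by
  have : Nonempty {A : Set O // MeasurableSet A} := ⟨⟨∅, MeasurableSet.empty⟩⟩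
  refine ciSup_le fun A => ?_
  obtain ⟨hi, he⟩ := P.outputLaw_real_apply μ D A.2
  obtain ⟨hi', he'⟩ := P.outputLaw_real_apply μ D' A.2
  rw [he, he', ← integral_sub hi hi']
  have hb := norm_integral_le_of_norm_le_const (μ := μ) (C := ε)
    (f := fun ω => D.real {G | (P.det ω).output G ∈ A.1} - D'.real {G | (P.det ω).output G ∈ A.1})
    (Filter.Eventually.of_forall fun ω => h ω A.1)
  simpa using hb

/-! ### The bound -/

lemma two_mul_sqrt_bound_le {M s C d : ℕ} (hs : s < M) (hC : 0 < C) (hd : 0 < d)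
    (hr : 40 * (C : ℝ) / ((M : ℝ) - s) ≤ 1) :
    2 * (s * (2 * √(M * (((C : ℝ) + 2) / (M - s)) ^ d)))
      ≤ 2 * (M : ℝ) ^ 2 * (40 * (C : ℝ) / ((M : ℝ) - s)) ^ (((d + 1 : ℕ) : ℝ) / 6) := by
  have hsM : (s : ℝ) < M := by exact_mod_cast hs
  have hM1 : (1 : ℝ) ≤ M := by exact_mod_cast (by omega : 1 ≤ M)
  have hC1 : (1 : ℝ) ≤ C := by exact_mod_cast hC
  have hd1 : (1 : ℝ) ≤ d := by exact_mod_cast hd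
  have hpos : (0 : ℝ) < M - s := by linarith
  set r : ℝ := 40 * (C : ℝ) / ((M : ℝ) - s) with hrdef
  have hr0 : 0 < r := by positivity
  -- C ≥ 1 gives C + 2 ≤ 3C.
  have hq : ((C : ℝ) + 2) / (M - s) ≤ 3 / 40 * r := by
    rw [hrdef, div_le_iff₀ hpos]
    field_simp
    linarith
  have hq0 : 0 ≤ ((C : ℝ) + 2) / (M - s) := by positivity
  have hsq : √(M * (((C : ℝ) + 2) / (M - s)) ^ d) ≤ M * r ^ (((d + 1 : ℕ) : ℝ) / 6) / 2 := by
    refine Real.sqrt_le_iff.2 ⟨by positivity, ?_⟩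
    have h1 : (r ^ (((d + 1 : ℕ) : ℝ) / 6)) ^ 2 = r ^ (((d : ℝ) + 1) / 3) := by
      rw [← Real.rpow_natCast, ← Real.rpow_mul hr0.le]
      congr 1
      push_cast
      ring
    -- Here r ≤ 1, and d ≥ (d + 1)/3 because d ≥ 1.
    have h2 : r ^ d ≤ r ^ (((d : ℝ) + 1) / 3) := by
      rw [← Real.rpow_natCast]
      exact Real.rpow_le_rpow_of_exponent_ge hr0 hr (by linarith)
    have h3 : (((C : ℝ) + 2) / (M - s)) ^ d ≤ 1 / 4 * r ^ d := by
      refine (pow_le_pow_left₀ hq0 hq d).trans ?_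
      rw [mul_pow]
      refine mul_le_mul_of_nonneg_right ?_ (by positivity)
      exact (pow_le_of_le_one (by norm_num) (by norm_num) hd.ne').trans (by norm_num)
    calc (M : ℝ) * (((C : ℝ) + 2) / (M - s)) ^ d
        ≤ M * (1 / 4 * r ^ (((d : ℝ) + 1) / 3)) := by
          refine mul_le_mul_of_nonneg_left (h3.trans ?_) (by linarith)
          linarith
      _ ≤ M ^ 2 * (1 / 4 * r ^ (((d : ℝ) + 1) / 3)) := by
          refine mul_le_mul_of_nonneg_right ?_ (by positivity)
          nlinarith
      _ = _ := by rw [div_pow, mul_pow, h1]; ring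
  calc 2 * (s * (2 * √(M * (((C : ℝ) + 2) / (M - s)) ^ d)))
      ≤ 2 * ((M : ℝ) * (2 * (M * r ^ (((d + 1 : ℕ) : ℝ) / 6) / 2))) := by
        gcongr
    _ = _ := by ring

lemma one_le_bound_of_one_le {M s C : ℕ} {x : ℝ} (hs : s < M) (hx : 0 ≤ x)
    (hr : 1 ≤ 40 * (C : ℝ) / ((M : ℝ) - s)) :
    1 ≤ 2 * (M : ℝ) ^ 2 * (40 * (C : ℝ) / ((M : ℝ) - s)) ^ x := by
  have hM1 : (1 : ℝ) ≤ M := by exact_mod_cast (by omega : 1 ≤ M)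
  have := Real.one_le_rpow hr hx
  nlinarith

/-- This serves c = 1, where there is no decaying factor: the base is at least 1/M, and the
prefactor 2M² outweighs it. -/
lemma one_le_bound_of_exponent_le_one {M s C : ℕ} {x : ℝ} (hs : s < M) (hC : 0 < C) (hx : x ≤ 1)
    (hr : 40 * (C : ℝ) / ((M : ℝ) - s) ≤ 1) :
    1 ≤ 2 * (M : ℝ) ^ 2 * (40 * (C : ℝ) / ((M : ℝ) - s)) ^ x := by
  have hsM : (s : ℝ) < M := by exact_mod_cast hs
  have hM1 : (1 : ℝ) ≤ M := by exact_mod_cast (by omega : 1 ≤ M)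
  have hC1 : (1 : ℝ) ≤ C := by exact_mod_cast hC
  have hpos : (0 : ℝ) < M - s := by linarith
  have h1 : 40 * (C : ℝ) / ((M : ℝ) - s) ≤ (40 * (C : ℝ) / ((M : ℝ) - s)) ^ x := by
    simpa using Real.rpow_le_rpow_of_exponent_ge (by positivity) hr hx
  have h2 : 1 / (M : ℝ) ≤ 40 * (C : ℝ) / ((M : ℝ) - s) := by
    have : (0 : ℝ) ≤ s := Nat.cast_nonneg s
    gcongr <;> linarith
  calc (1 : ℝ) ≤ 2 * M ^ 2 * (1 / M) := by field_simp; linarith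
    _ ≤ _ := mul_le_mul_of_nonneg_left (h2.trans h1) (by positivity)

end FinalMatching

theorem lemma3p2 (s₁ s₂ : ℕ) (hs₁ : 0 < s₁) (hS : s₁ < s₂) (c C : ℕ) (hc : 0 < c) (hC : 0 < C)
    (side : Side) (s : ℕ) (hs : 0 < s) (hss₁ : s ≤ s₁) (Y N : Fin s ↪ Fin s₁)
    {Ω O : Type*} [MeasurableSpace Ω] [MeasurableSpace O]
    (μ : Measure Ω) [IsProbabilityMeasure μ]
    (P : RandProtocol 1 (almostNest side s c [s₁, s₂]) Ω O) (hP : P.cost ≤ C) :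
    tvDist (P.outputLaw μ (almostNestedDistCond side s c [s₁, s₂] Y))
        (P.outputLaw μ (almostNestedDistCond side s c [s₁, s₂] N))
      ≤ 2 * (s₂ : ℝ) ^ 2 * (40 * (C : ℝ) / ((s₂ : ℝ) - (s : ℝ))) ^ ((c : ℝ) / 6) := by
  obtain ⟨hT, hZ⟩ := almostNest_nice_and_final_iff side hc hss₁ hS.le
  obtain ⟨u, v, huv⟩ := hZ Y
  obtain ⟨u', v', huv'⟩ := hZ N
  have hsM : s < s₂ := hss₁.trans_lt hS
  unfold almostNestedDistCond almostNestedDist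
  refine P.tvDist_outputLaw_le μ _ _ fun ω A => ?_
  -- Allowing the zero measure avoids having to show that the conditioning events have positive
  -- probability.
  have htriv : ∀ D D' : Measure (LayeredGraph (almostNest side s c [s₁, s₂])),
      IsZeroOrProbabilityMeasure D → IsZeroOrProbabilityMeasure D' → ∀ B, |D.real B - D'.real B| ≤ 1 := by
    intro D D' _ _ B
    have h1 : D.real B ≤ 1 := measureReal_le_one
    have h2 : D'.real B ≤ 1 := measureReal_le_one
    have h3 : 0 ≤ D.real B := measureReal_nonneg
    have h4 : 0 ≤ D'.real B := measureReal_nonneg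
    rw [abs_le]
    constructor <;> linarith
  rcases le_total 1 (40 * (C : ℝ) / ((s₂ : ℝ) - (s : ℝ))) with hr | hr
  · exact (htriv _ _ inferInstance inferInstance _).trans
      (one_le_bound_of_one_le hsM (by positivity) hr)
  · obtain ⟨d, rfl⟩ : ∃ d, c = d + 1 := ⟨c - 1, by omega⟩
    rcases Nat.eq_zero_or_pos d with rfl | hd
    · exact (htriv _ _ inferInstance inferInstance _).trans
        (one_le_bound_of_exponent_le_one hsM hC (by norm_num) hr)
    · exact (abs_cond_real_output_sub_le hT hsM (P.det ω) (P.bits_le hP ω) A _ _ u v u' v' huv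
        huv').trans (two_mul_sqrt_bound_le hsM hC hd hr)
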